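/- **Theorem (Smooth Call Prices).** Let $M\ge 1$, let $0=T_0<T_1<\dots<T_M$ be expiries and $0=K^0<K^1<\dots<K^N$ strikes. For $j=0,\dots,M-1$ let $\alpha_j:[T_j,T_{j+1}]\to[0,1]$ be non-decreasing with $\alpha_j(T_j)=0$, $\alpha_j(T_{j+1})=1$. Let $Y=(Y_1,\dots,Y_M)$ be an (a.s.) positive martingale with $\mathbb E[Y_j]=1$. Let $q=(q_1,\dots,q_M)$ be a *martingale density*: $q_j^i\ge 0$, $\sum_{i=1}^N q_j^i=1$, $\sum_{i=1}^N q_j^iK^i=1$, and for $2\le j\le M$ there is a matrix $Q\in\mathbb R^{N\times N}_{\ge0}$ with $\sum_i Q^{i|\ell}=1$, $\sum_iK^iQ^{i|\ell}=K^\ell$ for all $\ell$, and $q_j=Q\,q_{j-1}$. Put $\hat C_0(K):=(1-K)^+$ and $$\hat C_j(K):=\sum_{i=1}^N q_j^i\,\mathbb E[(K^iY_j-K)^+],\qquad 1\le j\le M,\ K\ge0,$$ $$\hat C(T,K):=\alpha_j(T)\hat C_{j+1}(K)+(1-\alpha_j(T))\hat C_j(K)\quad(T_j\le T<T_{j+1}),\qquad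 \hat C(T,K):=\hat C_M(K)\quad(T\ge T_M).$$ A function $C:[0,\infty)^2\to[0,\infty)$ is called an arbitrage-free call price function if there is a positive martingale $(Z_T)_{T\ge0}$ on some probability space with $Z_0=1$ a.s. and $C(T,K)=\mathbb E[(Z_T-K)^+]$ for all $T,K\ge 0$; $Z$ is then a martingale representation of $C$. Then: 1. $\hat C$ is an arbitrage-free call price function. 2. *(Smoothness in strike.)* Suppose that the distribution function of each $Y_j$ has a strictly positive right-hand derivative at every $y>0$. Then $\partial_{KK}\hat C(T,K)>0$ for all $K>0$ (derivatives in $K$ being right-hand derivatives) and all $T>0$ such that, if $T<T_1$, also $\alpha_0(T)>0$. If the distribution functions have strictly positive two-sided derivatives on $(0,\infty)$, then for all $T\ge T_1$ and $K>0$ the two-sided second derivative $\partial_{KK}\hat C(T,K)$ exists and is strictly positive. 3. *(Martingale representation.)* If $X=(X_1,\dots,X_M)$ is a martingale, independent of $Y$, with $\mathbb P(X_j=K^i)=q_j^i$ for all $i,j$, then $Z_j:=X_jY_j$ is a positive martingale and $\mathbb E[(Z_j-K)^+]=\hat C_j(K)$ for all $K\ge0$. Moreover, on some probability space there are such an $X$,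 independent of a copy of $Y$ (a process with the same joint law, again denoted $Y$), and a martingale representation $(Z_T)_{T\ge0}$ of the whole surface $\hat C$ with $Z_{T_j}=X_jY_j$ a.s. for $j=1,\dots,M$. 4. *(Comparison with linear interpolation.)* Let $C_j^i$ ($1\le j\le M$, $0\le i\le N$) be market call prices, let $dC_j^i:=\frac{C_j^{i+1}-C_j^i}{K^{i+1}-K^i}$ for $i<N$ and $dC_j^N:=0$, and let the market be free of arbitrage: $C_j^0=1$, $dC_j^0=-1$, $C_j^N=0$, $dC_j^i\le dC_j^{i+1}$ and $C_j^i\le C_{j+1}^i$. Let $\bar C_0(K):=(1-K)^+$, let $$\bar C_j(K):=\sum_{i=0}^{N-1}\mathbf 1_{K^i\le K<K^{i+1}}\big\{dC_j^i(K-K^{i+1})+C_j^{i+1}\big\}\qquad(1\le j\le M)$$ be the linear interpolant, and let $\bar C(T,K)$ be obtained from the $\bar C_j$ by the same interpolation in time. If $q$ is the market density, $q_j^i=dC_j^i-dC_j^{i-1}$ for all $1\le i\le N$ and $1\le j\le M$, then $\hat C_j(K)\ge\bar C_j(K)$ for all $j$ and $K\ge0$, with equality for every $j$ such that $Y_j=1$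 a.s.; if $Y_j=1$ a.s. for all $j$, then $\hat C(T,K)=\bar C(T,K)$ for all $T,K\ge0$. -/

import Mathlib

open MeasureTheory ProbabilityTheory Set Filter
open scoped NNReal Matrix

noncomputable section

namespace SmoothCalls

/-- `Z` is a martingale representation of the call price function `C`: a positive martingale
with `Z 0 = 1` a.s. such that `C T K = E[(Z T - K)⁺]` for all expiries `T ≥ 0` and all
strikes `K ≥ 0`. -/
structure IsMartingaleRepresentation (C : ℝ≥0 → ℝ → ℝ) {Ω : Type*} {mΩ : MeasurableSpace Ω}
    (P : Measure Ω) (ℱ : Filtration ℝ≥0 mΩ) (Z : ℝ≥0 → Ω → ℝ) : Prop where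
  martingale : Martingale Z ℱ P
  pos : ∀ᵐ ω ∂P, ∀ t, 0 < Z t ω
  start : ∀ᵐ ω ∂P, Z 0 ω = 1
  price : ∀ (t : ℝ≥0) (K : ℝ), 0 ≤ K → C t K = ∫ ω, max (Z t ω - K) 0 ∂P

/-- Arbitrage-free call price function (surface). -/
def IsArbitrageFree (C : ℝ≥0 → ℝ → ℝ) : Prop :=
  ∃ (Ω : Type) (mΩ : MeasurableSpace Ω) (P : Measure Ω) (_ : IsProbabilityMeasure P)
    (ℱ : Filtration ℝ≥0 mΩ) (Z : ℝ≥0 → Ω → ℝ), IsMartingaleRepresentation C P ℱ Z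

/-- Smoothness in strike of the call prices `c` of one expiry: `∂_KK c (K) > 0` for all `K > 0`,
where derivatives in strike are right-hand derivatives. -/
def IsSmoothInStrike (c : ℝ → ℝ) : Prop :=
  ∃ c₁ c₂ : ℝ → ℝ, ∀ K : ℝ, 0 < K →
    HasDerivWithinAt c (c₁ K) (Ioi K) K ∧ HasDerivWithinAt c₁ (c₂ K) (Ioi K) K ∧ 0 < c₂ K

/-- The same property with ordinary (two-sided) derivatives. -/
def IsTwoSidedSmoothInStrike (c : ℝ → ℝ) : Prop :=
  ∃ c₁ c₂ : ℝ → ℝ, ∀ K : ℝ, 0 < K →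
    HasDerivAt c (c₁ K) K ∧ HasDerivAt c₁ (c₂ K) K ∧ 0 < c₂ K

/-- Discrete martingale transition operator with respect to the strikes `k`; the columns
correspond to the conditioning state. -/
structure IsMartingaleTransition {N : ℕ} (k : Fin N → ℝ) (A : Matrix (Fin N) (Fin N) ℝ) :
    Prop where
  nonneg : ∀ i l, 0 ≤ A i l
  sum_one : ∀ l, ∑ i, A i l = 1
  mean : ∀ l, ∑ i, k i * A i l = k l

/-- Martingale density `q_1, …, q_M` (indexed here by `Fin M`) over the strikes `k`. -/
structure IsMartingaleDensity {M N : ℕ} (k : Fin N → ℝ) (q : Fin M → Fin N → ℝ) : Prop where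
  nonneg : ∀ j i, 0 ≤ q j i
  sum_one : ∀ j, ∑ i, q j i = 1
  unit_mean : ∀ j, ∑ i, q j i * k i = 1
  transition : ∀ j j' : Fin M, (j : ℕ) + 1 = (j' : ℕ) →
    ∃ A : Matrix (Fin N) (Fin N) ℝ, IsMartingaleTransition k A ∧ q j' = A *ᵥ q j

/-- `C_j(K) = ∑ i, q^i E[(K^i Y - K)⁺]` for one expiry. -/
def mixedCall {N : ℕ} (k q : Fin N → ℝ) {Ω : Type*} {mΩ : MeasurableSpace Ω}
    (P : Measure Ω) (Y : Ω → ℝ) (K : ℝ) : ℝ :=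
  ∑ i, q i * ∫ ω, max (k i * Y ω - K) 0 ∂P

/-- Adds the trivial prices `(1 - K)⁺` at the expiry `T_0 = 0` to the prices `c` at the expiries
`T_1, …, T_M`; the result is indexed by `0, …, M`. -/
def withStart {M : ℕ} (c : Fin M → ℝ → ℝ) : Fin (M + 1) → ℝ → ℝ :=
  Fin.cons (fun K => max (1 - K) 0) c

/-- Interpolation in time along fixed strikes,
`C(t,K) = α_j(t) C_{j+1}(K) + (1 - α_j(t)) C_j(K)` for `T_j ≤ t < T_{j+1}`,
continued by `C(t,K) = C_M(K)` for `t ≥ T_M`. -/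
def interpTime {M : ℕ} (T : Fin (M + 1) → ℝ≥0) (α : Fin M → ℝ≥0 → ℝ)
    (c : Fin (M + 1) → ℝ → ℝ) (t : ℝ≥0) (K : ℝ) : ℝ :=
  ∑ j : Fin M, (Ico (T j.castSucc) (T j.succ)).indicator
      (fun s => α j s * c j.succ K + (1 - α j s) * c j.castSucc K) t
    + (Ici (T (Fin.last M))).indicator (fun _ => c (Fin.last M) K) t

/-- The surface of the model: strikes `K^1, …, K^N` are `fun i => Kg i.succ`. -/
def modelSurface {M N : ℕ} (T : Fin (M + 1) → ℝ≥0) (α : Fin M → ℝ≥0 → ℝ) (k : Fin N → ℝ)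
    (q : Fin M → Fin N → ℝ) {Ω : Type*} {mΩ : MeasurableSpace Ω} (P : Measure Ω)
    (Y : Fin M → Ω → ℝ) : ℝ≥0 → ℝ → ℝ :=
  interpTime T α (withStart fun j => mixedCall k (q j) P (Y j))

/-- Difference quotients `dC^0, …, dC^N` of call prices of one expiry, with `dC^N = 0`. -/
def dC {N : ℕ} (Kg C : Fin (N + 1) → ℝ) : Fin (N + 1) → ℝ :=
  Fin.snoc (α := fun _ => ℝ)
    (fun i : Fin N => (C i.succ - C i.castSucc) / (Kg i.succ - Kg i.castSucc)) 0

/-- Market density `p^i = dC^i - dC^{i-1}`, `i = 1, …, N`. -/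
def marketDensity {N : ℕ} (Kg C : Fin (N + 1) → ℝ) (i : Fin N) : ℝ :=
  dC Kg C i.succ - dC Kg C i.castSucc

/-- Arbitrage-free market of call prices `C_j^i` on the strikes `0 = K^0 < ⋯ < K^N`. -/
structure IsArbitrageFreeMarket {M N : ℕ} (Kg : Fin (N + 1) → ℝ)
    (C : Fin M → Fin (N + 1) → ℝ) : Prop where
  unit_expectation : ∀ j, C j 0 = 1
  zero_unattainable : ∀ j, dC Kg (C j) 0 = -1
  reaches_zero : ∀ j, C j (Fin.last N) = 0
  convex : ∀ j, Monotone (dC Kg (C j))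
  increasing : ∀ i, Monotone fun j => C j i

/-- Linear interpolation in strike of the call prices of one expiry. -/
def linearCall {N : ℕ} (Kg C : Fin (N + 1) → ℝ) (K : ℝ) : ℝ :=
  ∑ i : Fin N, (Ico (Kg i.castSucc) (Kg i.succ)).indicator
    (fun x => dC Kg C i.castSucc * (x - Kg i.succ) + C i.succ) K

/-- Surface of the linear interpolation. -/
def linearSurface {M N : ℕ} (T : Fin (M + 1) → ℝ≥0) (α : Fin M → ℝ≥0 → ℝ)
    (Kg : Fin (N + 1) → ℝ) (C : Fin M → Fin (N + 1) → ℝ) : ℝ≥0 → ℝ → ℝ :=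
  interpTime T α (withStart fun j => linearCall Kg (C j))

/-- `X ∼ q`: `X` is a martingale with `P(X_j = K^i) = q_j^i`. -/
structure IsMartingaleWithDensity {M N : ℕ} (k : Fin N → ℝ) (q : Fin M → Fin N → ℝ)
    {Ω : Type*} {mΩ : MeasurableSpace Ω} (P : Measure Ω) (X : Fin M → Ω → ℝ) : Prop where
  martingale : ∃ 𝓗 : Filtration (Fin M) mΩ, Martingale X 𝓗 P
  law : ∀ j i, P.real {ω | X j ω = k i} = q j i

end SmoothCalls

end

/-! Let $X\sim q$ be independent of $Y$. Conditioning on the finitely many values of $X_j$ turns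
$\mathbb E[(X_jY_j-K)^+]$ into $\hat C_j(K)$ (`integral_call_mul`), and a product of independent
martingales is a martingale (`Martingale.mul_of_indep`). Such an $X$ exists because the transition
matrices define a Markov chain (`exists_chain`).

Interpolation in time is a random time change. Prepend $W_0=1$ to $W_j=X_jY_j$, take one uniform
variable $U$ independent of $W$, and for $T_j\le t<T_{j+1}$ read $W_{j+1}$ if $U\le\alpha_j(t)$ and
$W_j$ otherwise. As $\alpha_j$ is non-decreasing, the index read is non-decreasing in $t$; once $U$
is known from the start it is a stopping time, so optional sampling gives a martingale
(`Martingale.exists_timeChange`). Averaging over $U$ gives the weights $\alpha_j(t)$ and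
$1-\alpha_j(t)$ (`exists_representation_interpTime`).

Smoothness: $K\mapsto\mathbb E[(Y-K)^+]$ has slope $-(1-F(K))$ wherever the distribution function
$F$ is continuous (`hasDerivWithinAt_call`), so its second derivative is that of $F$ once; scaling
by $K^i$ and mixing keep it positive.

Comparison: summation by parts writes the linear interpolant as $\sum_i q^i(K^i-K)^+$
(`linearCall_eq_sum`), the model price for $Y=1$; Jensen's inequality does the rest. -/

namespace SmoothCalls

/-! ### Martingales: products, transfer by law, time change -/

section Martingales

variable {Ω Ω' ι : Type*} {mΩ : MeasurableSpace Ω} {mΩ' : MeasurableSpace Ω'} {P : Measure Ω}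

theorem martingale_of_setIntegral_eq [Preorder ι] [IsFiniteMeasure P] {f : ι → Ω → ℝ}
    {ℱ : Filtration ι mΩ} (hadp : ∀ i, StronglyMeasurable[ℱ i] (f i))
    (hint : ∀ i, Integrable (f i) P)
    (h : ∀ i j, i ≤ j → ∀ s, MeasurableSet[ℱ i] s → ∫ ω in s, f i ω ∂P = ∫ ω in s, f j ω ∂P) :
    Martingale f ℱ P := by
  refine ⟨hadp, fun i j hij => ?_⟩
  exact (ae_eq_condExp_of_forall_setIntegral_eq (ℱ.le i) (hint j)
    (fun s _ _ => (hint i).integrableOn) (fun s hs _ => h i j hij s hs)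
    (hadp i).aestronglyMeasurable).symm

theorem setIntegral_eq_of_isPiSystem {m : MeasurableSpace Ω} (hm : m ≤ mΩ) {S : Set (Set Ω)}
    (hS : m = MeasurableSpace.generateFrom S) (hpi : IsPiSystem S) {f g : Ω → ℝ}
    (hf : Integrable f P) (hg : Integrable g P) (huniv : ∫ ω, f ω ∂P = ∫ ω, g ω ∂P)
    (h : ∀ s ∈ S, ∫ ω in s, f ω ∂P = ∫ ω in s, g ω ∂P) {s : Set Ω} (hs : MeasurableSet[m] s) :
    ∫ ω in s, f ω ∂P = ∫ ω in s, g ω ∂P := by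
  induction s, hs using MeasurableSpace.induction_on_inter hS hpi with
  | empty => simp
  | basic t ht => exact h t ht
  | compl t ht ih =>
    have h1 := integral_add_compl (hm t ht) hf
    have h2 := integral_add_compl (hm t ht) hg
    linarith
  | iUnion t hd ht ih =>
    rw [integral_iUnion (fun i => hm _ (ht i)) hd hf.integrableOn,
      integral_iUnion (fun i => hm _ (ht i)) hd hg.integrableOn]
    exact tsum_congr ih

/-- The intersections `a ∩ b` with `a ∈ 𝓗 i`, `b ∈ 𝒢 i` form a π-system generating the joined
σ-algebra. On them the integral of the product factorises at every time `k ≥ i`, and each factor is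
constant in `k` by its own martingale property. -/
theorem _root_.MeasureTheory.Martingale.mul_of_indep [Preorder ι] [IsProbabilityMeasure P]
    {X Y : ι → Ω → ℝ} {𝓗 𝒢 : Filtration ι mΩ} (hX : Martingale X 𝓗 P) (hY : Martingale Y 𝒢 P)
    (hind : ∀ i, Indep (𝓗 i) (𝒢 i) P) :
    Martingale (fun i ω => X i ω * Y i ω) (𝓗 ⊔ 𝒢) P := by
  have hindep : ∀ i, IndepFun (X i) (Y i) P := fun i =>
    indep_of_indep_of_le_left (indep_of_indep_of_le_right (hind i)
      (hY.stronglyMeasurable i).measurable.comap_le) (hX.stronglyMeasurable i).measurable.comap_le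
  have hint : ∀ i, Integrable (fun ω => X i ω * Y i ω) P := fun i =>
    (hindep i).integrable_mul (hX.integrable i) (hY.integrable i)
  refine martingale_of_setIntegral_eq (fun i => ?_) hint fun i j hij s hs => ?_
  · exact StronglyMeasurable.mul ((hX.stronglyMeasurable i).mono le_sup_left)
      ((hY.stronglyMeasurable i).mono le_sup_right)
  set S : Set (Set Ω) := {s | ∃ a b, MeasurableSet[𝓗 i] a ∧ MeasurableSet[𝒢 i] b ∧ s = a ∩ b}
  have hrect : ∀ k, i ≤ k → ∀ a b, MeasurableSet[𝓗 i] a → MeasurableSet[𝒢 i] b →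
      ∫ ω in a ∩ b, X k ω * Y k ω ∂P = (∫ ω in a, X k ω ∂P) * ∫ ω in b, Y k ω ∂P := by
    intro k hk a b ha hb
    have ha' := (𝓗.le i) a ha
    have hb' := (𝒢.le i) b hb
    rw [← integral_indicator (ha'.inter hb'), ← integral_indicator ha', ← integral_indicator hb']
    have hi : IndepFun (a.indicator (X k)) (b.indicator (Y k)) P :=
      indep_of_indep_of_le_left (indep_of_indep_of_le_right (hind k)
        ((hY.stronglyMeasurable k).indicator (𝒢.mono hk b hb)).measurable.comap_le)
        ((hX.stronglyMeasurable k).indicator (𝓗.mono hk a ha)).measurable.comap_le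
    rw [← hi.integral_fun_mul_eq_mul_integral
      ((hX.integrable k).indicator ha').aestronglyMeasurable
      ((hY.integrable k).indicator hb').aestronglyMeasurable]
    congr 1 with ω
    by_cases h1 : ω ∈ a <;> by_cases h2 : ω ∈ b <;> simp [h1, h2]
  have heq : ∀ a b, MeasurableSet[𝓗 i] a → MeasurableSet[𝒢 i] b →
      ∫ ω in a ∩ b, X i ω * Y i ω ∂P = ∫ ω in a ∩ b, X j ω * Y j ω ∂P := fun a b ha hb => by
    rw [hrect i le_rfl a b ha hb, hrect j hij a b ha hb, hX.setIntegral_eq hij ha,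
      hY.setIntegral_eq hij hb]
  have hgen : (𝓗 ⊔ 𝒢) i = MeasurableSpace.generateFrom S := by
    refine le_antisymm (sup_le (fun a ha => ?_) fun b hb => ?_)
      (MeasurableSpace.generateFrom_le ?_)
    · exact MeasurableSpace.measurableSet_generateFrom
        ⟨a, univ, ha, @MeasurableSet.univ _ (𝒢 i), by simp⟩
    · exact MeasurableSpace.measurableSet_generateFrom
        ⟨univ, b, @MeasurableSet.univ _ (𝓗 i), hb, by simp⟩
    · rintro _ ⟨a, b, ha, hb, rfl⟩
      exact @MeasurableSet.inter _ ((𝓗 ⊔ 𝒢) i) _ _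
        ((le_sup_left : 𝓗 i ≤ 𝓗 i ⊔ 𝒢 i) a ha) ((le_sup_right : 𝒢 i ≤ 𝓗 i ⊔ 𝒢 i) b hb)
  refine setIntegral_eq_of_isPiSystem ((𝓗 ⊔ 𝒢).le i) hgen ?_ (hint i) (hint j) ?_ ?_ hs
  · rintro _ ⟨a, b, ha, hb, rfl⟩ _ ⟨a', b', ha', hb', rfl⟩ -
    exact ⟨a ∩ a', b ∩ b', @MeasurableSet.inter _ (𝓗 i) _ _ ha ha',
      @MeasurableSet.inter _ (𝒢 i) _ _ hb hb', inter_inter_inter_comm _ _ _ _⟩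
  · simpa using heq univ univ (@MeasurableSet.univ _ (𝓗 i)) (@MeasurableSet.univ _ (𝒢 i))
  · rintro _ ⟨a, b, ha, hb, rfl⟩
    exact heq a b ha hb

/-- The filtration generated by a process, as the pullback of the canonical filtration on the
path space. -/
def pathFiltration [Preorder ι] (f : ι → Ω → ℝ) (hf : ∀ i, Measurable (f i)) :
    Filtration ι mΩ where
  seq i := (Filtration.piLE (X := fun _ : ι => ℝ) i).comap (fun ω j => f j ω)
  mono' _ _ hij := MeasurableSpace.comap_mono (Filtration.piLE.mono hij)
  le' i := (MeasurableSpace.comap_mono (Filtration.piLE.le i)).trans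
    (measurable_pi_lambda _ hf).comap_le

theorem pathFiltration_le [Preorder ι] {f : ι → Ω → ℝ} (hf : ∀ i, Measurable (f i))
    {ℱ : Filtration ι mΩ} (hadp : ∀ i, StronglyMeasurable[ℱ i] (f i)) (i : ι) :
    pathFiltration f hf i ≤ ℱ i := by
  change ((MeasurableSpace.pi.comap (Preorder.restrictLe i)).comap fun ω j => f j ω) ≤ ℱ i
  rw [MeasurableSpace.comap_comp]
  refine Measurable.comap_le (@measurable_pi_lambda _ _ _ (ℱ i) _ _ fun j => ?_)
  exact ((hadp j).mono (ℱ.mono j.2)).measurable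

theorem pathFiltration_le_comap [Preorder ι] {f : ι → Ω → ℝ} (hf : ∀ i, Measurable (f i))
    (i : ι) : pathFiltration f hf i ≤ MeasurableSpace.comap (fun ω j => f j ω) inferInstance :=
  MeasurableSpace.comap_mono (Filtration.piLE.le i)

theorem stronglyMeasurable_pathFiltration [Preorder ι] {f : ι → Ω → ℝ}
    (hf : ∀ i, Measurable (f i)) (i : ι) : StronglyMeasurable[pathFiltration f hf i] (f i) := by
  have h : Measurable[Filtration.piLE (X := fun _ : ι => ℝ) i] (fun x : ι → ℝ => x i) := by
    have : (fun x : ι → ℝ => x i) =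
        (fun y : Iic i → ℝ => y ⟨i, le_rfl⟩) ∘ Preorder.restrictLe i := rfl
    rw [this]
    exact (measurable_pi_apply _).comp (comap_measurable _)
  exact (h.comp (comap_measurable _)).stronglyMeasurable

theorem _root_.MeasureTheory.Martingale.pathFiltration [Preorder ι] [IsFiniteMeasure P]
    {f : ι → Ω → ℝ} {ℱ : Filtration ι mΩ} (h : Martingale f ℱ P) (hf : ∀ i, Measurable (f i)) :
    Martingale f (pathFiltration f hf) P :=
  martingale_of_setIntegral_eq (stronglyMeasurable_pathFiltration hf) h.integrable
    fun i _ hij s hs => h.setIntegral_eq hij (pathFiltration_le hf h.1 i s hs)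

/-- Being a martingale for the natural filtration is a property of the joint law alone: each event
of that filtration is the preimage of a set of paths, so the set integrals to compare are integrals
of one path functional. -/
theorem _root_.MeasureTheory.Martingale.of_identDistrib [Preorder ι] [Countable ι]
    {P' : Measure Ω'} [IsFiniteMeasure P] [IsFiniteMeasure P'] {f : ι → Ω → ℝ} {g : ι → Ω' → ℝ}
    {ℱ : Filtration ι mΩ} (h : Martingale f ℱ P) (hg : ∀ i, Measurable (g i))
    (hfg : IdentDistrib (fun ω i => g i ω) (fun ω i => f i ω) P' P) :
    Martingale g (SmoothCalls.pathFiltration g hg) P' := by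
  have hf : ∀ i, Measurable (f i) := fun i => ((h.1 i).mono (ℱ.le i)).measurable
  have hcoord : ∀ i, IdentDistrib (g i) (f i) P' P := fun i => hfg.comp (measurable_pi_apply i)
  refine martingale_of_setIntegral_eq (stronglyMeasurable_pathFiltration hg)
    (fun i => (hcoord i).integrable_iff.2 (h.integrable i)) ?_
  rintro i j hij _ ⟨s, hs, rfl⟩
  have hs' : MeasurableSet s := Filtration.piLE.le i s hs
  have key : ∀ k, ∫ ω in (fun ω i => g i ω) ⁻¹' s, g k ω ∂P' =
      ∫ ω in (fun ω i => f i ω) ⁻¹' s, f k ω ∂P := by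
    intro k
    rw [← integral_indicator (measurable_pi_lambda _ hg hs'),
      ← integral_indicator (measurable_pi_lambda _ hf hs')]
    exact (hfg.comp ((measurable_pi_apply k).indicator hs')).integral_eq
  rw [key, key]
  exact (h.pathFiltration hf).setIntegral_eq hij ⟨s, hs, rfl⟩

/-- A discrete martingale stopped at an increasing family of stopping times is a martingale. -/
theorem _root_.MeasureTheory.Martingale.exists_timeChange [Preorder ι] [IsFiniteMeasure P] {n : ℕ}
    {W : Fin (n + 1) → Ω → ℝ} {𝒢 : Filtration (Fin (n + 1)) mΩ} (hW : Martingale W 𝒢 P)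
    {ρ : ι → Ω → Fin (n + 1)} (hρ : ∀ t i, MeasurableSet[𝒢 i] {ω | ρ t ω ≤ i})
    (hmono : ∀ ω, Monotone fun t => ρ t ω) :
    ∃ ℱ : Filtration ι mΩ, Martingale (fun t ω => W (ρ t ω) ω) ℱ P := by
  have hst : ∀ t, IsStoppingTime 𝒢 (fun ω => ((ρ t ω : Fin (n + 1)) : WithTop (Fin (n + 1)))) :=
    fun t i => by simpa using hρ t i
  have hle : ∀ s t, s ≤ t → (fun ω => ((ρ s ω : Fin (n + 1)) : WithTop (Fin (n + 1)))) ≤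
      fun ω => ((ρ t ω : Fin (n + 1)) : WithTop (Fin (n + 1))) := fun s t hst ω => by
    simpa using hmono ω hst
  have hval : ∀ t, stoppedValue W (fun ω => ((ρ t ω : Fin (n + 1)) : WithTop (Fin (n + 1)))) =
      fun ω => W (ρ t ω) ω := fun t => by
    ext ω; simp [stoppedValue]
  -- The filtration at `t` is the σ-algebra of events prior to the stopping time `ρ t`; optional
  -- sampling applies because all these times are bounded by the last index.
  refine ⟨⟨fun t => (hst t).measurableSpace, fun s t h => (hst s).measurableSpace_mono (hst t)
    (hle s t h), fun t => (hst t).measurableSpace_le⟩, fun t => ?_, fun s t h => ?_⟩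
  · have := (measurable_stoppedValue hW.stronglyAdapted.isStronglyProgressive_of_discrete
      (hst t)).stronglyMeasurable
    rwa [hval t] at this
  · have := hW.stoppedValue_ae_eq_condExp_of_le (n := Fin.last n) (hst t) (hst s) (hle s t h)
      (fun ω => by simpa using Fin.le_last _)
    rw [hval, hval] at this
    exact this.symm

end Martingales

/-! ### Strike derivatives of call prices -/

section CallPrices

variable {Ω : Type*} {mΩ : MeasurableSpace Ω} {P : Measure Ω}

theorem integrable_call [IsFiniteMeasure P] {f : Ω → ℝ} (hf : Integrable f P) (K : ℝ) :
    Integrable (fun ω => max (f ω - K) 0) P :=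
  (hf.sub (integrable_const K)).pos_part

/-- The right-continuous version of minus the slope is a subgradient of the call price. -/
theorem call_subgradient [IsProbabilityMeasure P] {Y : Ω → ℝ} (hYm : Measurable Y)
    (hY : Integrable Y P) (a b : ℝ) :
    ∫ ω, max (Y ω - a) 0 ∂P - (b - a) * (1 - P.real {ω | Y ω ≤ a}) ≤
      ∫ ω, max (Y ω - b) 0 ∂P := by
  have hs : MeasurableSet {ω | Y ω ≤ a} := measurableSet_le hYm measurable_const
  have h1 : (b - a) * (1 - P.real {ω | Y ω ≤ a}) =
      ∫ ω, {ω | Y ω ≤ a}ᶜ.indicator (fun _ => b - a) ω ∂P := by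
    rw [integral_indicator_const _ hs.compl, probReal_compl_eq_one_sub hs, smul_eq_mul, mul_comm]
  have hind : Integrable ({ω | Y ω ≤ a}ᶜ.indicator fun _ => b - a) P :=
    (integrable_const _).indicator hs.compl
  rw [h1, ← integral_sub (integrable_call hY a) hind]
  refine integral_mono ((integrable_call hY a).sub hind) (integrable_call hY b) fun ω => ?_
  by_cases h : Y ω ≤ a
  · simp [h]
  · have h' := not_le.1 h
    have h0 : max (Y ω - a) 0 = Y ω - a := max_eq_left (by linarith)
    simp [h, h0]

/-- The subgradient inequalities at `K` and at `x` trap the error of the linear approximation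
between `0` and `(x - K) * (F x - F K)`, where `F` is the distribution function. Continuity of `F`
at `K` within `s` makes this `o(x - K)`. -/
theorem hasDerivWithinAt_call [IsProbabilityMeasure P] {Y : Ω → ℝ} (hYm : Measurable Y)
    (hY : Integrable Y P) {s : Set ℝ} {K : ℝ}
    (hF : ContinuousWithinAt (fun x => P.real {ω | Y ω ≤ x}) s K) :
    HasDerivWithinAt (fun x => ∫ ω, max (Y ω - x) 0 ∂P) (-(1 - P.real {ω | Y ω ≤ K})) s K := by
  rw [hasDerivWithinAt_iff_isLittleO, Asymptotics.isLittleO_iff]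
  intro ε hε
  filter_upwards [Metric.tendsto_nhds.1 hF ε hε] with x hx
  rw [Real.dist_eq] at hx
  have h1 := call_subgradient hYm hY K x
  have h2 := call_subgradient hYm hY x K
  have h3 : (x - K) * (P.real {ω | Y ω ≤ x} - P.real {ω | Y ω ≤ K}) ≤ ε * |x - K| := by
    refine (le_abs_self _).trans ?_
    rw [abs_mul, mul_comm]
    exact mul_le_mul_of_nonneg_right hx.le (abs_nonneg _)
  rw [Real.norm_eq_abs, Real.norm_eq_abs, smul_eq_mul, abs_of_nonneg (by linarith)]
  nlinarith

/-- First and second derivatives of `c` at the strikes `K > 0`, within the sets `S K`. -/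
def HasStrikeDerivs (S : ℝ → Set ℝ) (c c₁ c₂ : ℝ → ℝ) : Prop :=
  ∀ K : ℝ, 0 < K → HasDerivWithinAt c (c₁ K) (S K) K ∧ HasDerivWithinAt c₁ (c₂ K) (S K) K

theorem HasStrikeDerivs.mix {S : ℝ → Set ℝ} {c c₁ c₂ d d₁ d₂ : ℝ → ℝ}
    (hc : HasStrikeDerivs S c c₁ c₂) (hd : HasStrikeDerivs S d d₁ d₂) (a b : ℝ) :
    HasStrikeDerivs S (fun K => a * c K + b * d K) (fun K => a * c₁ K + b * d₁ K)
      (fun K => a * c₂ K + b * d₂ K) := fun K hK =>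
  ⟨((hc K hK).1.const_mul a).add ((hd K hK).1.const_mul b),
    ((hc K hK).2.const_mul a).add ((hd K hK).2.const_mul b)⟩

/-- From the right, the kink at `K = 1` is invisible: the slope is already `0` there and is locally
constant to the right of every point. Two-sided derivatives do not exist at `1`, which is why the
two-sided claim starts at $T_1$. -/
theorem hasStrikeDerivs_start :
    HasStrikeDerivs Ioi (fun K => max (1 - K) 0) (fun K => if K < 1 then -1 else 0)
      (fun _ => 0) := by
  intro K _
  by_cases h : K < 1
  · have hev : ∀ᶠ x in nhdsWithin K (Ioi K), x < 1 :=
      nhdsWithin_le_nhds (eventually_lt_nhds h)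
    constructor
    · refine ((hasDerivWithinAt_id K (Ioi K)).const_sub 1).congr_of_eventuallyEq ?_ ?_ |>.congr_deriv
        (by simp [h])
      · filter_upwards [hev] with x hx using max_eq_left (by simpa using hx.le)
      · exact max_eq_left (by simpa using h.le)
    · refine (hasDerivWithinAt_const K (Ioi K) (-1 : ℝ)).congr_of_eventuallyEq ?_ (if_pos h)
      filter_upwards [hev] with x hx using if_pos hx
  · have h1 : 1 ≤ K := not_lt.1 h
    constructor
    · refine ((hasDerivWithinAt_const K (Ioi K) (0 : ℝ)).congr (fun x hx => ?_) ?_).congr_deriv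
        (by simp [h])
      · exact max_eq_right (by linarith [mem_Ioi.1 hx])
      · exact max_eq_right (by linarith)
    · refine (hasDerivWithinAt_const K (Ioi K) (0 : ℝ)).congr (fun x hx => ?_) (if_neg h)
      exact if_neg (by linarith [mem_Ioi.1 hx])

/-- By homogeneity $(kY-K)^+=k\,(Y-K/k)^+$, so the chain rule reduces everything to the price of
`Y`. The condition `hS` is what the chain rule asks of the sets `S`; right half-lines and the whole
line both satisfy it, so one proof serves both kinds of derivative. -/
theorem hasStrikeDerivs_mixedCall [IsProbabilityMeasure P] {N : ℕ} {k q : Fin N → ℝ}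
    (hk : ∀ i, 0 < k i) {Y : Ω → ℝ} (hYm : Measurable Y) (hY : Integrable Y P) {S : ℝ → Set ℝ}
    (hS : ∀ a K : ℝ, 0 < a → MapsTo (fun x => x / a) (S K) (S (K / a))) {f : ℝ → ℝ}
    (hf : ∀ y, 0 < y → HasDerivWithinAt (fun x => P.real {ω | Y ω ≤ x}) (f y) (S y) y) :
    HasStrikeDerivs S (mixedCall k q P Y)
      (fun K => ∑ i, q i * -(1 - P.real {ω | Y ω ≤ K / k i}))
      (fun K => ∑ i, q i * (f (K / k i) / k i)) := by
  have hform : mixedCall k q P Y =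
      fun K => ∑ i, q i * (k i * ∫ ω, max (Y ω - K / k i) 0 ∂P) := by
    ext K
    refine Finset.sum_congr rfl fun i _ => ?_
    rw [← integral_const_mul (k i)]
    refine congrArg (q i * ·) (integral_congr_ae (.of_forall fun ω => ?_))
    simp only
    rw [mul_max_of_nonneg _ _ (hk i).le, mul_zero, mul_sub, mul_div_cancel₀ _ (hk i).ne']
  intro K hK
  have hdiv : ∀ i, HasDerivWithinAt (fun x => x / k i) (1 / k i) (S K) K := fun i =>
    (hasDerivWithinAt_id K (S K)).div_const (k i)
  constructor
  · rw [hform]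
    refine HasDerivWithinAt.fun_sum fun i _ => ?_
    have h := (hasDerivWithinAt_call hYm hY (hf _ (div_pos hK (hk i))).continuousWithinAt).comp K
      (hdiv i) (hS (k i) K (hk i))
    refine (((h.const_mul (k i)).const_mul (q i))).congr_deriv ?_
    have := (hk i).ne'
    field_simp
  · refine HasDerivWithinAt.fun_sum fun i _ => ?_
    have h := (hf _ (div_pos hK (hk i))).comp K (hdiv i) (hS (k i) K (hk i))
    refine ((((h.const_sub 1).neg).const_mul (q i))).congr_deriv ?_
    ring

end CallPrices

/-! ### Interpolation in time -/

section Interpolation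

variable {M N : ℕ} {T : Fin (M + 1) → ℝ≥0} {α : Fin M → ℝ≥0 → ℝ}

theorem exists_mem_Ico_or_last_le (hT0 : T 0 = 0) (t : ℝ≥0) :
    (∃ j : Fin M, t ∈ Ico (T j.castSucc) (T j.succ)) ∨ T (Fin.last M) ≤ t := by
  have key : ∀ m : Fin (M + 1), t < T m → ∃ j : Fin M, t ∈ Ico (T j.castSucc) (T j.succ) := by
    intro m
    induction m using Fin.induction with
    | zero => intro h; simp [hT0] at h
    | succ j ih =>
      intro h
      rcases le_or_gt (T j.castSucc) t with h' | h'
      · exact ⟨j, h', h⟩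
      · exact ih h'
  rcases le_or_gt (T (Fin.last M)) t with h | h
  · exact Or.inr h
  · exact Or.inl (key _ h)

theorem eq_of_mem_Ico (hT : StrictMono T) {i j : Fin M} {t : ℝ≥0}
    (hi : t ∈ Ico (T i.castSucc) (T i.succ)) (hj : t ∈ Ico (T j.castSucc) (T j.succ)) : i = j := by
  by_contra hij
  rcases lt_or_gt_of_ne hij with h | h
  · exact absurd (hi.2.trans_le (hT.monotone (Fin.succ_le_castSucc_iff.2 h))) (not_lt.2 hj.1)
  · exact absurd (hj.2.trans_le (hT.monotone (Fin.succ_le_castSucc_iff.2 h))) (not_lt.2 hi.1)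

theorem interpTime_of_mem_Ico (hT : StrictMono T) (c : Fin (M + 1) → ℝ → ℝ) {j : Fin M}
    {t : ℝ≥0} (ht : t ∈ Ico (T j.castSucc) (T j.succ)) (K : ℝ) :
    interpTime T α c t K = α j t * c j.succ K + (1 - α j t) * c j.castSucc K := by
  have hlast : t ∉ Ici (T (Fin.last M)) := fun h =>
    absurd (ht.2.trans_le (hT.monotone (Fin.le_last _))) (not_lt.2 h)
  rw [interpTime, indicator_of_notMem hlast, add_zero, Finset.sum_eq_single j]
  · rw [indicator_of_mem ht]
  · intro i _ hij
    exact indicator_of_notMem (fun hi => hij (eq_of_mem_Ico hT hi ht)) _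
  · simp

theorem interpTime_of_last_le (hT : StrictMono T) (c : Fin (M + 1) → ℝ → ℝ) {t : ℝ≥0}
    (ht : T (Fin.last M) ≤ t) (K : ℝ) : interpTime T α c t K = c (Fin.last M) K := by
  rw [interpTime, indicator_of_mem (mem_Ici.2 ht), Finset.sum_eq_zero, zero_add]
  intro i _
  refine indicator_of_notMem (fun hi => ?_) _
  exact absurd (hi.2.trans_le (hT.monotone (Fin.le_last _))) (not_lt.2 ht)

theorem interpTime_congr {c d : Fin (M + 1) → ℝ → ℝ} {K : ℝ} (h : ∀ j, c j K = d j K) (t : ℝ≥0) :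
    interpTime T α c t K = interpTime T α d t K := by
  simp only [interpTime, h]

theorem mem_Icc_of_interpolation
    (hα : ∀ j, MonotoneOn (α j) (Icc (T j.castSucc) (T j.succ)))
    (hα0 : ∀ j, α j (T j.castSucc) = 0) (hα1 : ∀ j, α j (T j.succ) = 1) {j : Fin M} {t : ℝ≥0}
    (ht : t ∈ Icc (T j.castSucc) (T j.succ)) : α j t ∈ Icc (0 : ℝ) 1 := by
  have hle := ht.1.trans ht.2
  exact ⟨hα0 j ▸ hα j (left_mem_Icc.2 hle) ht ht.1, hα1 j ▸ hα j ht (right_mem_Icc.2 hle) ht.2⟩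

end Interpolation

/-! ### Linear interpolation in strike and Jensen's inequality -/

section LinearInterpolation

variable {N : ℕ}

/-- Summation by parts: the linear interpolant is the call price of the market density. -/
theorem linearCall_eq_sum {Kg C : Fin (N + 1) → ℝ} (hK0 : Kg 0 = 0) (hK : StrictMono Kg)
    (hC : C (Fin.last N) = 0) {K : ℝ} (h0 : 0 ≤ K) :
    linearCall Kg C K = ∑ i : Fin N, marketDensity Kg C i * max (Kg i.succ - K) 0 := by
  -- `L i` is the value at `K` of the line through node `i` with slope `dC i`. The lines `L
  -- i.castSucc` and `L i.succ` meet at node `i.succ`, so their difference is the market density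
  -- times `Kg i.succ - K`; increments of `χ` pick out the interval containing `K`.
  set L : Fin (N + 1) → ℝ := fun i => dC Kg C i * (K - Kg i) + C i with hL
  set χ : Fin (N + 1) → ℝ := fun i => if K < Kg i then 1 else 0 with hχ
  have hline : ∀ i : Fin N, dC Kg C i.castSucc * (K - Kg i.succ) + C i.succ = L i.castSucc := by
    intro i
    have hpos : Kg i.succ - Kg i.castSucc ≠ 0 :=
      (sub_pos.2 (hK (Fin.castSucc_lt_succ (i := i)))).ne'
    simp only [hL, dC, Fin.snoc_castSucc]
    field_simp
    ring
  have hleft : ∀ i : Fin N, (Ico (Kg i.castSucc) (Kg i.succ)).indicator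
      (fun x => dC Kg C i.castSucc * (x - Kg i.succ) + C i.succ) K =
        (χ i.succ - χ i.castSucc) * L i.castSucc := by
    intro i
    have hlt := hK (Fin.castSucc_lt_succ (i := i))
    rw [← hline i]
    simp only [indicator, mem_Ico, hχ]
    split_ifs <;> first | linarith | (exfalso; grind)
  have hright : ∀ i : Fin N, marketDensity Kg C i * max (Kg i.succ - K) 0 =
      χ i.succ * (L i.castSucc - L i.succ) := by
    intro i
    rw [← hline i]
    simp only [marketDensity, hL, hχ]
    split_ifs with h
    · rw [max_eq_left (by linarith)]; ring
    · rw [max_eq_right (by linarith)]; ring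
  -- Both boundary terms vanish: `χ 0 = 0` because `K ≥ 0`, and the last line is zero because the
  -- last slope and the last price are.
  have htel : ∑ i : Fin N, (χ i.succ * L i.succ - χ i.castSucc * L i.castSucc) = 0 := by
    rw [Finset.sum_sub_distrib]
    have h1 := Fin.sum_univ_succ fun i => χ i * L i
    have h2 := Fin.sum_univ_castSucc fun i => χ i * L i
    have hχ0 : χ 0 = 0 := if_neg (by rw [hK0]; exact not_lt.2 h0)
    have hlast : L (Fin.last N) = 0 := by simp [hL, dC, hC]
    rw [hχ0] at h1
    rw [hlast] at h2
    linarith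
  rw [linearCall, Finset.sum_congr rfl fun i _ => hleft i, Finset.sum_congr rfl fun i _ => hright i,
    ← sub_eq_zero, ← Finset.sum_sub_distrib, ← htel]
  exact Finset.sum_congr rfl fun i _ => by ring

variable {Ω : Type*} {mΩ : MeasurableSpace Ω} {P : Measure Ω}

/-- Jensen's inequality for each strike, using that `Y` has mean one. -/
theorem sum_intrinsic_le_mixedCall [IsProbabilityMeasure P] {k q : Fin N → ℝ} (hq : ∀ i, 0 ≤ q i)
    {Y : Ω → ℝ} (hY : Integrable Y P) (hmean : ∫ ω, Y ω ∂P = 1) (K : ℝ) :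
    ∑ i, q i * max (k i - K) 0 ≤ mixedCall k q P Y K := by
  refine Finset.sum_le_sum fun i _ => mul_le_mul_of_nonneg_left (max_le ?_ ?_) (hq i)
  · have hint := hY.const_mul (k i)
    calc k i - K = ∫ ω, (k i * Y ω - K) ∂P := by
          rw [integral_sub hint (integrable_const _), integral_const_mul, hmean]; simp
      _ ≤ _ := integral_mono (hint.sub (integrable_const _)) (integrable_call hint K)
          fun ω => le_max_left _ _
  · exact integral_nonneg fun ω => le_max_right _ _

theorem mixedCall_of_ae_eq_one [IsProbabilityMeasure P] {k q : Fin N → ℝ} {Y : Ω → ℝ}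
    (hY : ∀ᵐ ω ∂P, Y ω = 1) (K : ℝ) :
    mixedCall k q P Y K = ∑ i, q i * max (k i - K) 0 := by
  refine Finset.sum_congr rfl fun i _ => ?_
  have : (fun ω => max (k i * Y ω - K) 0) =ᵐ[P] fun _ => max (k i - K) 0 := by
    filter_upwards [hY] with ω h
    rw [h, mul_one]
  rw [integral_congr_ae this]
  simp

end LinearInterpolation

/-! ### The Markov chain with a given martingale density -/

section Chain

variable {N : ℕ}

/-- Selecting one of several variables independent of `m` by an `m`-measurable index. -/
theorem condExp_select {Ω : Type*} {m mΩ : MeasurableSpace Ω} {P : Measure Ω}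
    [IsProbabilityMeasure P] (hm : m ≤ mΩ) {J : Ω → Fin N} (hJ : Measurable[m] J)
    {V : Fin N → Ω → ℝ} (hV : ∀ l, Measurable (V l)) (hint : ∀ l, Integrable (V l) P)
    (hind : ∀ l, Indep (MeasurableSpace.comap (V l) inferInstance) m P) :
    P[fun ω => V (J ω) ω | m] =ᵐ[P] fun ω => ∫ ω', V (J ω) ω' ∂P := by
  have hset : ∀ l, MeasurableSet[m] (J ⁻¹' {l}) := fun l => hJ (measurableSet_singleton l)
  have hsum : (fun ω => V (J ω) ω) = ∑ l, (J ⁻¹' {l}).indicator (V l) := by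
    ext ω
    rw [Finset.sum_apply, Finset.sum_eq_single (J ω)]
    · simp
    · intro l _ hl
      exact indicator_of_notMem (fun h => hl (by simpa using h.symm)) _
    · simp
  rw [hsum]
  refine (condExp_finsetSum (fun l _ => (hint l).indicator (hm _ (hset l))) m).trans ?_
  have h1 : ∀ᵐ ω ∂P, ∀ l, (P[(J ⁻¹' {l}).indicator (V l) | m]) ω =
      (J ⁻¹' {l}).indicator (fun _ => ∫ ω', V l ω' ∂P) ω := by
    refine ae_all_iff.2 fun l => ?_
    filter_upwards [condExp_indicator (hint l) (hset l),
      condExp_indep_eq (hV l).comap_le hm (comap_measurable (V l)).stronglyMeasurable (hind l)]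
      with ω h h'
    rw [h]
    by_cases hω : ω ∈ J ⁻¹' {l}
    · rw [indicator_of_mem hω, indicator_of_mem hω, h']
    · rw [indicator_of_notMem hω, indicator_of_notMem hω]
  filter_upwards [h1] with ω h
  rw [Finset.sum_apply, Finset.sum_congr rfl fun l _ => h l, Finset.sum_eq_single (J ω)]
  · simp
  · intro l _ hl
    exact indicator_of_notMem (fun h => hl (by simpa using h.symm)) _
  · simp

theorem exists_probabilityMeasure_fin {p : Fin N → ℝ} (h0 : ∀ i, 0 ≤ p i) (h1 : ∑ i, p i = 1) :
    ∃ ν : Measure (Fin N), IsProbabilityMeasure ν ∧ ∀ i, ν.real {i} = p i := by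
  refine ⟨(PMF.ofFintype (fun i => ENNReal.ofReal (p i)) ?_).toMeasure, inferInstance, fun i => ?_⟩
  · rw [← ENNReal.ofReal_sum_of_nonneg fun i _ => h0 i, h1, ENNReal.ofReal_one]
  · rw [Measure.real, PMF.toMeasure_apply_singleton _ _ (measurableSet_singleton i),
      PMF.ofFintype_apply, ENNReal.toReal_ofReal (h0 i)]

theorem integrable_comp_fin {Ω : Type*} {mΩ : MeasurableSpace Ω} {P : Measure Ω}
    [IsFiniteMeasure P] {J : Ω → Fin N} (hJ : Measurable J) (g : Fin N → ℝ) :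
    Integrable (fun ω => g (J ω)) P :=
  Integrable.of_bound ((measurable_of_finite g).comp hJ).aestronglyMeasurable (∑ i, |g i|)
    (.of_forall fun ω => Finset.single_le_sum (f := fun i => |g i|) (fun _ _ => abs_nonneg _)
      (Finset.mem_univ (J ω)))

theorem integral_comp_fin {Ω : Type*} {mΩ : MeasurableSpace Ω} {P : Measure Ω}
    [IsProbabilityMeasure P] {J : Ω → Fin N} (hJ : Measurable J) (g : Fin N → ℝ) :
    ∫ ω, g (J ω) ∂P = ∑ l, P.real {ω | J ω = l} * g l := by
  have := integral_map (μ := P) hJ.aemeasurable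
    (measurable_of_finite g).aestronglyMeasurable (f := g)
  have hp : IsProbabilityMeasure (P.map J) := Measure.isProbabilityMeasure_map hJ.aemeasurable
  rw [← this, integral_fintype Integrable.of_finite]
  refine Finset.sum_congr rfl fun l _ => ?_
  rw [map_measureReal_apply hJ (measurableSet_singleton l), smul_eq_mul]
  rfl

/-- Existence of the Markov chain with a given initial law and given transitions; it is built from
independent random maps. -/
theorem exists_chain {k : Fin N → ℝ} {q₀ : Fin N → ℝ} (h0 : ∀ i, 0 ≤ q₀ i)
    (h1 : ∑ i, q₀ i = 1) {A : ℕ → Matrix (Fin N) (Fin N) ℝ}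
    (hA : ∀ n, IsMartingaleTransition k (A n)) :
    ∃ (Ω : Type) (mΩ : MeasurableSpace Ω) (P : Measure Ω) (_ : IsProbabilityMeasure P)
      (𝓕 : Filtration ℕ mΩ) (I : ℕ → Ω → Fin N),
      (∀ n, Measurable (I n)) ∧ Martingale (fun n ω => k (I n ω)) 𝓕 P ∧
      (∀ i, P.real {ω | I 0 ω = i} = q₀ i) ∧
      ∀ n i, P.real {ω | I (n + 1) ω = i} = ∑ l, A n i l * P.real {ω | I n ω = l} := by
  have hne : Nonempty (Fin N) := by
    by_contra h
    rw [not_nonempty_iff] at h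
    simp at h1
  obtain ⟨l₀⟩ := hne
  have hν : ∀ x : ℕ × Fin N, ∃ ν : Measure (Fin N), IsProbabilityMeasure ν ∧
      ∀ i, ν.real {i} = (match x.1 with | 0 => q₀ i | n + 1 => A n i x.2) := by
    rintro ⟨n, l⟩
    cases n with
    | zero => exact exists_probabilityMeasure_fin h0 h1
    | succ n => exact exists_probabilityMeasure_fin (fun i => (hA n).nonneg i l) ((hA n).sum_one l)
  choose ν hνp hν using hν
  -- The coordinate `(n + 1, l)` is the successor of state `l` at step `n + 1`, drawn independently
  -- of all others. At time `0` every coordinate has the initial law, and `l₀` merely selects one of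
  -- them.
  let P : Measure (ℕ × Fin N → Fin N) := Measure.infinitePi ν
  let I : ℕ → (ℕ × Fin N → Fin N) → Fin N := fun n ω => Nat.rec (ω (0, l₀)) (fun n l => ω (n + 1, l)) n
  let S : ℕ → Finset (ℕ × Fin N) := fun n => Finset.range (n + 1) ×ˢ Finset.univ
  have hS : Monotone S := fun a b hab =>
    Finset.product_subset_product_left (Finset.range_mono (Nat.add_le_add_right hab 1))
  let 𝓕 : Filtration ℕ (MeasurableSpace.pi : MeasurableSpace (ℕ × Fin N → Fin N)) :=
    ⟨fun n => Filtration.piFinset (X := fun _ => Fin N) (S n),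
      fun a b hab => Filtration.piFinset.mono (hS hab), fun n => Filtration.piFinset.le _⟩
  have hcoord : ∀ n m l, m ≤ n → Measurable[𝓕 n] (fun ω : ℕ × Fin N → Fin N => ω (m, l)) := by
    intro n m l h
    have hmem : (m, l) ∈ S n := by simp [S]; omega
    have : (fun ω : ℕ × Fin N → Fin N => ω (m, l)) =
        (fun y : S n → Fin N => y ⟨(m, l), hmem⟩) ∘ (S n).restrict := rfl
    rw [this]
    exact (measurable_pi_apply _).comp (comap_measurable _)
  have hI : ∀ n, Measurable[𝓕 n] (I n) := by
    intro n
    induction n with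
    | zero => exact hcoord 0 0 l₀ le_rfl
    | succ n ih =>
      have h2 : Measurable[𝓕 (n + 1)] (I n) := ih.mono (𝓕.mono n.le_succ) le_rfl
      refine @measurable_to_countable' _ _ _ _ (𝓕 (n + 1)) _ fun i => ?_
      have : I (n + 1) ⁻¹' {i} = ⋃ l, (I n ⁻¹' {l} ∩
          (fun ω : ℕ × Fin N → Fin N => ω (n + 1, l)) ⁻¹' {i}) := by
        ext ω
        simp [I]
      rw [this]
      exact MeasurableSet.iUnion fun l => MeasurableSet.inter (h2 (measurableSet_singleton l))
        (hcoord (n + 1) (n + 1) l le_rfl (measurableSet_singleton i))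
  have hIm : ∀ n, Measurable (I n) := fun n => (hI n).mono (𝓕.le n) le_rfl
  have hev : ∀ x, Measurable fun ω : ℕ × Fin N → Fin N => ω x := fun x => measurable_pi_apply x
  have hlaw : ∀ x i, P.real {ω | ω x = i} = (ν x).real {i} := by
    intro x i
    rw [← Measure.infinitePi_map_eval ν x, map_measureReal_apply (measurable_pi_apply x)
      (measurableSet_singleton i)]
    rfl
  have hindep : ∀ n l (g : Fin N → ℝ), Indep (MeasurableSpace.comap
      (fun ω : ℕ × Fin N → Fin N => g (ω (n + 1, l))) inferInstance) (𝓕 n) P := by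
    intro n l g
    have hi : iIndepFun (fun (x : ℕ × Fin N) (ω : ℕ × Fin N → Fin N) => ω x) P :=
      iIndepFun_infinitePi (X := fun _ => id) (fun _ => measurable_id)
    have hd : Disjoint {(n + 1, l)} (S n) := by simp [S]
    have := hi.indepFun_finset {(n + 1, l)} (S n) hd (fun x => measurable_pi_apply x)
    refine indep_of_indep_of_le_left this ?_
    refine Measurable.comap_le ((measurable_of_finite g).comp ?_)
    have hsingle : Measurable fun y : ({(n + 1, l)} : Finset (ℕ × Fin N)) → Fin N =>
        y ⟨(n + 1, l), Finset.mem_singleton_self _⟩ := measurable_pi_apply _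
    exact hsingle.comp (comap_measurable _)
  -- This is the Markov property. With `g = k` it gives the martingale property, and with `g` the
  -- indicator of a state, after taking expectations, the recursion for the laws.
  have hsel : ∀ n (g : Fin N → ℝ), P[fun ω => g (I (n + 1) ω) | 𝓕 n] =ᵐ[P]
      fun ω => ∑ i, A n i (I n ω) * g i := by
    intro n g
    refine (condExp_select (𝓕.le n) (hI n) (V := fun l ω => g (ω (n + 1, l)))
      (fun l => (measurable_of_finite g).comp (hev _)) (fun l => integrable_comp_fin (hev _) g)
      fun l => hindep n l g).trans (.of_forall fun ω => ?_)
    simp only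
    rw [integral_comp_fin (hev _) g]
    simp only [hlaw, hν]
  refine ⟨_, _, P, inferInstance, 𝓕, I, hIm, martingale_nat (fun n => ?_)
    (fun n => integrable_comp_fin (hIm n) k) fun n => ?_, fun i => ?_, fun n i => ?_⟩
  · exact ((measurable_of_finite k).comp (hI n)).stronglyMeasurable
  · refine EventuallyEq.trans (.of_forall fun ω => ?_) (hsel n k).symm
    simp only
    rw [← (hA n).mean (I n ω)]
    exact Finset.sum_congr rfl fun i _ => mul_comm _ _
  · exact (hlaw (0, l₀) i).trans (hν _ i)
  · have h2 := integral_comp_fin (P := P) (hIm (n + 1)) (fun j => if j = i then 1 else 0)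
    rw [← integral_condExp (𝓕.le n), integral_congr_ae (hsel n fun j => if j = i then 1 else 0)] at h2
    simp only [mul_ite, mul_one, mul_zero, Finset.sum_ite_eq', Finset.mem_univ, if_true] at h2
    rw [← h2, integral_comp_fin (hIm n) (fun l => A n i l)]
    exact Finset.sum_congr rfl fun l _ => mul_comm _ _

theorem isMartingaleTransition_one (k : Fin N → ℝ) : IsMartingaleTransition k 1 where
  nonneg i l := by rw [Matrix.one_apply]; split_ifs <;> norm_num
  sum_one l := by simp [Matrix.one_apply]
  mean l := by simp [Matrix.one_apply]

theorem exists_isMartingaleWithDensity {M : ℕ} (hM : 0 < M) {k : Fin N → ℝ}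
    (hk : Function.Injective k) {q : Fin M → Fin N → ℝ} (hq : IsMartingaleDensity k q) :
    ∃ (Ω : Type) (_ : MeasurableSpace Ω) (P : Measure Ω) (_ : IsProbabilityMeasure P)
      (X : Fin M → Ω → ℝ), IsMartingaleWithDensity k q P X := by
  -- The chain runs over all of `ℕ`, so beyond the last expiry the identity matrix serves as
  -- transition.
  have hA : ∀ n : ℕ, ∃ A : Matrix (Fin N) (Fin N) ℝ, IsMartingaleTransition k A ∧
      ∀ h : n + 1 < M, q ⟨n + 1, h⟩ = A *ᵥ q ⟨n, n.lt_succ_self.trans h⟩ := by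
    intro n
    by_cases h : n + 1 < M
    · obtain ⟨A, hA, hqA⟩ := hq.transition ⟨n, n.lt_succ_self.trans h⟩ ⟨n + 1, h⟩ rfl
      exact ⟨A, hA, fun _ => hqA⟩
    · exact ⟨1, isMartingaleTransition_one k, fun h' => absurd h' h⟩
  choose A hA hqA using hA
  obtain ⟨Ω, mΩ, P, hP, 𝓕, I, -, hmart, hI0, hIs⟩ :=
    exists_chain (hq.nonneg ⟨0, hM⟩) (hq.sum_one ⟨0, hM⟩) hA
  refine ⟨Ω, mΩ, P, hP, fun j ω => k (I j ω), ⟨⟨fun j => 𝓕 j, fun a b h => 𝓕.mono h,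
    fun j => 𝓕.le j⟩, fun j => hmart.1 j, fun a b h => hmart.2 a b h⟩, ?_⟩
  rintro ⟨j, hj⟩
  simp only [hk.eq_iff]
  induction j with
  | zero => exact hI0
  | succ n ih =>
    intro i
    rw [hIs, hqA n hj, Matrix.mulVec, dotProduct]
    exact Finset.sum_congr rfl fun l _ => by rw [ih]

end Chain

/-! ### Products of a finitely valued martingale with an independent one -/

section Products

variable {M N : ℕ} {Ω : Type*} {mΩ : MeasurableSpace Ω} {P : Measure Ω}

theorem measurable_of_martingale {ι : Type*} [Preorder ι] {f : ι → Ω → ℝ} {ℱ : Filtration ι mΩ}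
    (h : Martingale f ℱ P) (i : ι) : Measurable (f i) :=
  ((h.1 i).mono (ℱ.le i)).measurable

/-- The given filtrations need not be independent, but the natural ones are, since they are
generated by the paths; so both martingales are first moved to their natural filtrations. -/
theorem exists_martingale_mul [IsProbabilityMeasure P] {X Y : Fin M → Ω → ℝ}
    {𝓗 𝒢 : Filtration (Fin M) mΩ} (hX : Martingale X 𝓗 P) (hY : Martingale Y 𝒢 P)
    (hind : IndepFun (fun ω j => X j ω) (fun ω j => Y j ω) P) :
    ∃ 𝓚 : Filtration (Fin M) mΩ, Martingale (fun j ω => X j ω * Y j ω) 𝓚 P :=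
  ⟨_, (hX.pathFiltration (measurable_of_martingale hX)).mul_of_indep
    (hY.pathFiltration (measurable_of_martingale hY)) fun i =>
      indep_of_indep_of_le_left (indep_of_indep_of_le_right hind (pathFiltration_le_comap _ i))
        (pathFiltration_le_comap _ i)⟩

/-- The atoms at the distinct points `k i` already carry total mass one, which leaves no mass for
other values. -/
theorem ae_exists_eq_of_density [IsProbabilityMeasure P] {k q : Fin N → ℝ}
    (hk : Function.Injective k) (hq : ∑ i, q i = 1) {X : Ω → ℝ} (hX : Measurable X)
    (hlaw : ∀ i, P.real {ω | X ω = k i} = q i) : ∀ᵐ ω ∂P, ∃ i, X ω = k i := by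
  have hms : ∀ i, MeasurableSet {ω | X ω = k i} := fun i => hX (measurableSet_singleton (k i))
  have hU : P.real (⋃ i, {ω | X ω = k i}) = 1 := by
    rw [measureReal_iUnion_fintype (fun i j hij => ?_) hms, ← hq]
    · exact Finset.sum_congr rfl fun i _ => hlaw i
    · exact Set.disjoint_left.2 fun ω h1 h2 => hij (hk (h1.symm.trans h2))
  have h1 : P (⋃ i, {ω | X ω = k i}) = 1 := by
    rw [← ENNReal.toReal_eq_one_iff]; exact hU
  filter_upwards [(prob_compl_eq_zero_iff (MeasurableSet.iUnion hms)).2 h1 |>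
    (mem_ae_iff (s := ⋃ i, {ω | X ω = k i})).2] with ω h
  simpa using h

theorem integral_call_mul [IsProbabilityMeasure P] {k q : Fin N → ℝ}
    (hk : Function.Injective k) (hq : ∑ i, q i = 1) {X Y : Ω → ℝ} (hX : Measurable X)
    (hYint : Integrable Y P)
    (hlaw : ∀ i, P.real {ω | X ω = k i} = q i) (hind : IndepFun X Y P) (K : ℝ) :
    ∫ ω, max (X ω * Y ω - K) 0 ∂P = mixedCall k q P Y K := by
  have hms : ∀ i, MeasurableSet {ω | X ω = k i} := fun i => hX (measurableSet_singleton (k i))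
  have hae : (fun ω => max (X ω * Y ω - K) 0) =ᵐ[P] fun ω =>
      ∑ i, ({k i} : Set ℝ).indicator (fun _ => (1 : ℝ)) (X ω) * max (k i * Y ω - K) 0 := by
    filter_upwards [ae_exists_eq_of_density hk hq hX hlaw] with ω ⟨i, hi⟩
    rw [Finset.sum_eq_single i]
    · simp [hi]
    · intro j _ hj
      have : X ω ≠ k j := fun h => hj (hk (h.symm.trans hi))
      simp [this]
    · simp
  have hintY : ∀ i, Integrable (fun ω => max (k i * Y ω - K) 0) P := fun i =>
    integrable_call (hYint.const_mul (k i)) K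
  have hone : ∀ i, Measurable (({k i} : Set ℝ).indicator fun _ => (1 : ℝ)) := fun i =>
    measurable_const.indicator (measurableSet_singleton (k i))
  have hcall : ∀ i, Measurable fun y : ℝ => max (k i * y - K) 0 := fun i => by fun_prop
  have hi : ∀ i, IndepFun (fun ω => ({k i} : Set ℝ).indicator (fun _ => (1 : ℝ)) (X ω))
      (fun ω => max (k i * Y ω - K) 0) P := fun i => hind.comp (hone i) (hcall i)
  have hintX : ∀ i, Integrable (fun ω => ({k i} : Set ℝ).indicator (fun _ => (1 : ℝ)) (X ω)) P :=
    fun i => (integrable_const (1 : ℝ)).indicator (hms i)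
  have hprod : ∀ i ∈ Finset.univ, Integrable (fun ω =>
      ({k i} : Set ℝ).indicator (fun _ => (1 : ℝ)) (X ω) * max (k i * Y ω - K) 0) P :=
    fun i _ => (hi i).integrable_mul (hintX i) (hintY i)
  rw [integral_congr_ae hae, integral_finsetSum _ hprod]
  refine Finset.sum_congr rfl fun i _ => ?_
  rw [(hi i).integral_fun_mul_eq_mul_integral (hintX i).aestronglyMeasurable
    (hintY i).aestronglyMeasurable]
  congr 1
  refine Eq.trans ?_ (hlaw i)
  exact (integral_indicator_const (1 : ℝ) (hms i)).trans (by simp)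

theorem ae_mul_pos [IsProbabilityMeasure P] {k q : Fin N → ℝ} (hk : Function.Injective k)
    (hkpos : ∀ i, 0 < k i) (hq : ∑ i, q i = 1) {X Y : Ω → ℝ} (hX : Measurable X)
    (hlaw : ∀ i, P.real {ω | X ω = k i} = q i) (hY : ∀ᵐ ω ∂P, 0 < Y ω) :
    ∀ᵐ ω ∂P, 0 < X ω * Y ω := by
  filter_upwards [ae_exists_eq_of_density hk hq hX hlaw, hY] with ω ⟨i, hi⟩ h
  rw [hi]
  exact mul_pos (hkpos i) h

theorem mixedCall_zero [IsProbabilityMeasure P] {k q : Fin N → ℝ} (hkpos : ∀ i, 0 < k i)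
    (hmean : ∑ i, q i * k i = 1) {Y : Ω → ℝ} (hY : ∀ᵐ ω ∂P, 0 < Y ω)
    (hYmean : ∫ ω, Y ω ∂P = 1) : mixedCall k q P Y 0 = 1 := by
  rw [← hmean]
  refine Finset.sum_congr rfl fun i _ => ?_
  have : (fun ω => max (k i * Y ω - 0) 0) =ᵐ[P] fun ω => k i * Y ω := by
    filter_upwards [hY] with ω h
    rw [sub_zero, max_eq_left (mul_pos (hkpos i) h).le]
  rw [integral_congr_ae this, integral_const_mul, hYmean, mul_one]

/-- A unit-mean martingale can be started at the constant `1`. -/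
theorem exists_martingale_cons [IsProbabilityMeasure P] {W : Fin M → Ω → ℝ}
    {𝓗 : Filtration (Fin M) mΩ} (hW : Martingale W 𝓗 P) (hmean : ∀ j, ∫ ω, W j ω ∂P = 1) :
    ∃ 𝓚 : Filtration (Fin (M + 1)) mΩ,
      Martingale (Fin.cons (fun _ => 1) W : Fin (M + 1) → Ω → ℝ) 𝓚 P := by
  -- The trivial σ-algebra is put at time zero: conditioning on it is taking the mean, which is `1`.
  refine ⟨⟨Fin.cons ⊥ fun j => 𝓗 j, fun i j hij => ?_, fun i => ?_⟩, fun i => ?_, fun i j hij => ?_⟩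
  · induction i using Fin.cases with
    | zero => exact bot_le
    | succ i =>
      induction j using Fin.cases with
      | zero => exact absurd hij (by simp)
      | succ j => exact 𝓗.mono (Fin.succ_le_succ_iff.1 hij)
  · induction i using Fin.cases with
    | zero => exact bot_le
    | succ i => exact 𝓗.le i
  · induction i using Fin.cases with
    | zero => exact stronglyMeasurable_const
    | succ i => exact hW.1 i
  · induction i using Fin.cases with
    | zero =>
      change P[(Fin.cons (fun _ => 1) W : Fin (M + 1) → Ω → ℝ) j | ⊥] =ᵐ[P] fun _ => 1
      rw [condExp_bot]
      refine .of_forall fun _ => ?_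
      induction j using Fin.cases with
      | zero => simp
      | succ j => exact hmean j
    | succ i =>
      induction j using Fin.cases with
      | zero => exact absurd hij (by simp)
      | succ j => exact hW.2 i j (Fin.succ_le_succ_iff.1 hij)

theorem identDistrib_comp_snd {Ω₁ Ω₂ E : Type*} {m₁ : MeasurableSpace Ω₁}
    {m₂ : MeasurableSpace Ω₂} {mE : MeasurableSpace E} (μ : Measure Ω₁) (ν : Measure Ω₂)
    [IsProbabilityMeasure μ] [IsProbabilityMeasure ν] {f : Ω₂ → E} (hf : Measurable f) :
    IdentDistrib (fun ω : Ω₁ × Ω₂ => f ω.2) f (μ.prod ν) ν :=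
  ⟨(hf.comp measurable_snd).aemeasurable, hf.aemeasurable, by
    conv_rhs => rw [← (measurePreserving_snd (μ := μ) (ν := ν)).map_eq,
      Measure.map_map hf measurable_snd]
    rfl⟩

theorem identDistrib_comp_fst {Ω₁ Ω₂ E : Type*} {m₁ : MeasurableSpace Ω₁}
    {m₂ : MeasurableSpace Ω₂} {mE : MeasurableSpace E} (μ : Measure Ω₁) (ν : Measure Ω₂)
    [IsProbabilityMeasure μ] [IsProbabilityMeasure ν] {f : Ω₁ → E} (hf : Measurable f) :
    IdentDistrib (fun ω : Ω₁ × Ω₂ => f ω.1) f (μ.prod ν) μ :=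
  ⟨(hf.comp measurable_fst).aemeasurable, hf.aemeasurable, by
    conv_rhs => rw [← (measurePreserving_fst (μ := μ) (ν := ν)).map_eq,
      Measure.map_map hf measurable_fst]
    rfl⟩

end Products

/-! ### Random time change realising the interpolation in time -/

section TimeInterpolation

variable {M : ℕ} {T : Fin (M + 1) → ℝ≥0} {α : Fin M → ℝ≥0 → ℝ}

instance isProbabilityMeasure_uniform :
    IsProbabilityMeasure ((volume : Measure ℝ).restrict (Ioc 0 1)) := ⟨by simp⟩

theorem integral_uniform_ite {a : ℝ} (h0 : 0 ≤ a) (h1 : a ≤ 1) (x y : ℝ) :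
    ∫ u in Ioc (0 : ℝ) 1, (if u ≤ a then x else y) = a * x + (1 - a) * y := by
  have hform : (fun u : ℝ => if u ≤ a then x else y) =
      fun u => (Iic a).indicator (fun _ => x - y) u + y := by
    ext u
    by_cases h : u ≤ a <;> simp [h]
  have hreal : ((volume : Measure ℝ).restrict (Ioc 0 1)).real (Iic a) = a := by
    have : Iic a ∩ Ioc (0 : ℝ) 1 = Ioc 0 a := by
      ext u
      simp only [mem_inter_iff, mem_Iic, mem_Ioc]
      constructor
      · rintro ⟨h, h', -⟩; exact ⟨h', h⟩
      · rintro ⟨h, h'⟩; exact ⟨h', h, h'.trans h1⟩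
    rw [measureReal_restrict_apply measurableSet_Iic, this, Real.volume_real_Ioc_of_le h0, sub_zero]
  rw [hform, integral_add ((integrable_const _).indicator measurableSet_Iic) (integrable_const _),
    integral_indicator_const _ measurableSet_Iic, hreal]
  simp
  ring

/-- Random index of the expiry whose price is read at time `t`: it is the right endpoint of the
time interval of `t` if `u ≤ α j t`, and the left one otherwise. -/
theorem exists_expiryIndex (hT0 : T 0 = 0) (hT : StrictMono T) (t : ℝ≥0) :
    ∃ r : ℝ → Fin (M + 1), (∀ j : Fin M, t ∈ Ico (T j.castSucc) (T j.succ) →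
      r = fun u => if u ≤ α j t then j.succ else j.castSucc) ∧
      (T (Fin.last M) ≤ t → r = fun _ => Fin.last M) := by
  rcases exists_mem_Ico_or_last_le hT0 t with ⟨j, hj⟩ | h
  · refine ⟨fun u => if u ≤ α j t then j.succ else j.castSucc, fun i hi => ?_, fun h => ?_⟩
    · rw [eq_of_mem_Ico hT hi hj]
    · exact absurd (hj.2.trans_le (hT.monotone (Fin.le_last _))) (not_lt.2 h)
  · refine ⟨fun _ => Fin.last M, fun j hj => ?_, fun _ => rfl⟩
    exact absurd (hj.2.trans_le (hT.monotone (Fin.le_last _))) (not_lt.2 h)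

/-- A martingale at the expiries extends, on an enlarged probability space, to a martingale
representation of the call prices interpolated in time. -/
theorem exists_representation_interpTime (hT0 : T 0 = 0) (hT : StrictMono T)
    (hα : ∀ j, MonotoneOn (α j) (Icc (T j.castSucc) (T j.succ)))
    (hα0 : ∀ j, α j (T j.castSucc) = 0) (hα1 : ∀ j, α j (T j.succ) = 1)
    {Ω : Type} {mΩ : MeasurableSpace Ω} {P : Measure Ω} [IsProbabilityMeasure P]
    {W : Fin (M + 1) → Ω → ℝ} {𝓗 : Filtration (Fin (M + 1)) mΩ} (hW : Martingale W 𝓗 P)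
    (hW0 : ∀ᵐ ω ∂P, W 0 ω = 1) (hWpos : ∀ j, ∀ᵐ ω ∂P, 0 < W j ω)
    {c : Fin (M + 1) → ℝ → ℝ} (hc : ∀ j K, 0 ≤ K → ∫ ω, max (W j ω - K) 0 ∂P = c j K) :
    ∃ (ℱ : Filtration ℝ≥0 (inferInstance : MeasurableSpace (ℝ × Ω))) (Z : ℝ≥0 → ℝ × Ω → ℝ),
      IsMartingaleRepresentation (interpTime T α c)
        (((volume : Measure ℝ).restrict (Ioc 0 1)).prod P) ℱ Z ∧
      ∀ j, ∀ᵐ ω ∂((volume : Measure ℝ).restrict (Ioc 0 1)).prod P, Z (T j) ω = W j ω.2 := by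
  set U := (volume : Measure ℝ).restrict (Ioc 0 1) with hU
  have hWm : ∀ j, Measurable (W j) := measurable_of_martingale hW
  have hW'm : ∀ j, Measurable fun ω : ℝ × Ω => W j ω.2 := fun j => (hWm j).comp measurable_snd
  have hpath : Measurable fun (ω : Ω) j => W j ω := measurable_pi_lambda _ hWm
  have hmart := hW.of_identDistrib hW'm (identDistrib_comp_snd U P hpath)
  have hindep : IndepFun (fun ω : ℝ × Ω => ω.1) (fun ω : ℝ × Ω => ω.2) (U.prod P) :=
    indepFun_prod measurable_id measurable_id
  set 𝒰 : Filtration (Fin (M + 1)) (inferInstance : MeasurableSpace (ℝ × Ω)) :=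
    Filtration.const _ (MeasurableSpace.comap Prod.fst inferInstance) measurable_fst.comap_le
  -- Multiplying by the constant martingale `1` for the constant filtration of the uniform variable
  -- adjoins that variable to the filtration without changing the process. Every index `r t` is then
  -- known from the outset, hence a stopping time.
  have hmart' := (martingale_const 𝒰 (U.prod P) (1 : ℝ)).mul_of_indep hmart fun i =>
    indep_of_indep_of_le_right hindep ((pathFiltration_le_comap hW'm i).trans
      (Measurable.comap_le (hpath.comp (comap_measurable _))))
  simp only [one_mul] at hmart'
  choose r hr hrlast using exists_expiryIndex (α := α) hT0 hT
  have hrm : ∀ t, Measurable (r t) := by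
    intro t
    rcases exists_mem_Ico_or_last_le hT0 t with ⟨j, hj⟩ | h
    · rw [hr t j hj]
      exact Measurable.ite measurableSet_Iic measurable_const measurable_const
    · rw [hrlast t h]
      exact measurable_const
  -- Within one interval, `u ≤ α j s` persists at later times because `α j` is non-decreasing; a
  -- later interval only has larger indices.
  have hmono : ∀ u, Monotone fun t => r t u := by
    intro u s t hst
    rcases exists_mem_Ico_or_last_le hT0 t with ⟨j, hj⟩ | h
    · rcases exists_mem_Ico_or_last_le hT0 s with ⟨i, hi⟩ | h'
      · simp only [hr t j hj, hr s i hi]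
        rcases lt_trichotomy i j with hij | hij | hij
        · have h1 : i.succ ≤ j.castSucc := Fin.succ_le_castSucc_iff.2 hij
          have h2 := (Fin.castSucc_lt_succ (i := i)).le
          have h3 := (Fin.castSucc_lt_succ (i := j)).le
          split_ifs
          exacts [h1.trans h3, h1, (h2.trans h1).trans h3, h2.trans h1]
        · subst hij
          have hle := hα i ⟨hi.1, hi.2.le⟩ ⟨hj.1, hj.2.le⟩ hst
          split_ifs with h1 h2
          exacts [le_rfl, absurd (h1.trans hle) h2, (Fin.castSucc_lt_succ (i := i)).le, le_rfl]
        · exact absurd (hj.2.trans_le ((hT.monotone (Fin.succ_le_castSucc_iff.2 hij)).trans hi.1))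
            (not_lt.2 hst)
      · exact absurd (hj.2.trans_le ((hT.monotone (Fin.le_last _)).trans h')) (not_lt.2 hst)
    · simp only [hrlast t h]
      exact Fin.le_last _
  obtain ⟨ℱ, hℱ⟩ := hmart'.exists_timeChange (ρ := fun t ω => r t ω.1)
    (fun t i => (le_sup_left : 𝒰 i ≤ 𝒰 i ⊔ pathFiltration _ hW'm i) _
      ⟨r t ⁻¹' Iic i, hrm t measurableSet_Iic, rfl⟩) fun ω => hmono ω.1
  -- Strict positivity of `u` matters at the expiries: there `α j = 0`, so the test `u ≤ 0` fails
  -- and the left endpoint is read.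
  have hfst : ∀ᵐ ω ∂U.prod P, 0 < ω.1 := by
    have : ∀ᵐ u ∂U, 0 < u := by
      filter_upwards [ae_restrict_mem measurableSet_Ioc] with u hu using hu.1
    exact (measurePreserving_fst (μ := U) (ν := P)).quasiMeasurePreserving.ae this
  have hsnd : ∀ {p : Ω → Prop}, (∀ᵐ ω ∂P, p ω) → ∀ᵐ ω ∂U.prod P, p ω.2 := fun h =>
    (measurePreserving_snd (μ := U) (ν := P)).quasiMeasurePreserving.ae h
  have hnode : ∀ j, ∀ᵐ ω ∂U.prod P, W (r (T j) ω.1) ω.2 = W j ω.2 := by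
    intro j
    induction j using Fin.lastCases with
    | last => exact .of_forall fun ω => by rw [hrlast _ le_rfl]
    | cast j =>
      filter_upwards [hfst] with ω hω
      simp only [hr _ j ⟨le_rfl, hT Fin.castSucc_lt_succ⟩, hα0, if_neg (not_le.2 hω)]
  refine ⟨ℱ, fun t ω => W (r t ω.1) ω.2, ⟨hℱ, ?_, ?_, fun t K hK => ?_⟩, hnode⟩
  · filter_upwards [hsnd (ae_all_iff.2 hWpos)] with ω h t using h _
  · filter_upwards [hsnd hW0, hT0 ▸ hnode 0] with ω h h' using h'.trans h
  -- By Fubini the price is the average over `u` of the price at the index read, which is `α j t`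
  -- times one price plus `1 - α j t` times the other.
  · rw [integral_prod _ (integrable_call (hℱ.integrable t) K)]
    simp only [hc _ _ hK]
    rcases exists_mem_Ico_or_last_le hT0 t with ⟨j, hj⟩ | h
    · have hmem := mem_Icc_of_interpolation hα hα0 hα1 ⟨hj.1, hj.2.le⟩
      rw [interpTime_of_mem_Ico hT c hj, ← integral_uniform_ite hmem.1 hmem.2, hr t j hj]
      refine integral_congr_ae (.of_forall fun u => ?_)
      simp only
      split_ifs <;> rfl
    · rw [interpTime_of_last_le hT c h, hrlast t h]
      simp

end TimeInterpolation

/-! ### Positivity of the second strike derivative -/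

section Smoothness

variable {M N : ℕ} {T : Fin (M + 1) → ℝ≥0} {α : Fin M → ℝ≥0 → ℝ} {Ω : Type*}
  {mΩ : MeasurableSpace Ω} {P : Measure Ω}

/-- Smoothness in strike, with derivatives taken within the sets `S K`. -/
def SmoothWithin (S : ℝ → Set ℝ) (c : ℝ → ℝ) : Prop :=
  ∃ c₁ c₂ : ℝ → ℝ, HasStrikeDerivs S c c₁ c₂ ∧ ∀ K, 0 < K → 0 < c₂ K

theorem SmoothWithin.isSmoothInStrike {c : ℝ → ℝ} (h : SmoothWithin Ioi c) :
    IsSmoothInStrike c := by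
  obtain ⟨c₁, c₂, hd, hpos⟩ := h
  exact ⟨c₁, c₂, fun K hK => ⟨(hd K hK).1, (hd K hK).2, hpos K hK⟩⟩

theorem SmoothWithin.isTwoSidedSmoothInStrike {c : ℝ → ℝ} (h : SmoothWithin (fun _ => univ) c) :
    IsTwoSidedSmoothInStrike c := by
  obtain ⟨c₁, c₂, hd, hpos⟩ := h
  exact ⟨c₁, c₂, fun K hK => ⟨hasDerivWithinAt_univ.1 (hd K hK).1,
    hasDerivWithinAt_univ.1 (hd K hK).2, hpos K hK⟩⟩

theorem SmoothWithin.mix {S : ℝ → Set ℝ} {c d : ℝ → ℝ} (hc : SmoothWithin S c)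
    (hd : SmoothWithin S d) {a : ℝ} (ha : a ∈ Icc (0 : ℝ) 1) :
    SmoothWithin S fun K => a * c K + (1 - a) * d K := by
  obtain ⟨c₁, c₂, hc, hcpos⟩ := hc
  obtain ⟨d₁, d₂, hd, hdpos⟩ := hd
  refine ⟨_, _, hc.mix hd a (1 - a), fun K hK => ?_⟩
  rcases ha.1.eq_or_lt with h | h
  · subst h; simpa using hdpos K hK
  · exact add_pos_of_pos_of_nonneg (mul_pos h (hcpos K hK))
      (mul_nonneg (sub_nonneg.2 ha.2) (hdpos K hK).le)

/-- The initial prices have zero second right-hand derivative, so positivity comes from `c` alone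
and needs a positive weight on it. -/
theorem SmoothWithin.mix_start {c : ℝ → ℝ} (hc : SmoothWithin Ioi c) {a : ℝ} (ha : 0 < a) :
    SmoothWithin Ioi fun K => a * c K + (1 - a) * max (1 - K) 0 := by
  obtain ⟨c₁, c₂, hc, hcpos⟩ := hc
  refine ⟨_, _, hc.mix hasStrikeDerivs_start a (1 - a), fun K hK => ?_⟩
  rw [mul_zero, add_zero]
  exact mul_pos ha (hcpos K hK)

theorem smoothWithin_mixedCall [IsProbabilityMeasure P] {k q : Fin N → ℝ} (hk : ∀ i, 0 < k i)
    (hq0 : ∀ i, 0 ≤ q i) (hq1 : ∑ i, q i = 1) {Y : Ω → ℝ} (hYm : Measurable Y)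
    (hY : Integrable Y P) {S : ℝ → Set ℝ}
    (hS : ∀ a K : ℝ, 0 < a → MapsTo (fun x => x / a) (S K) (S (K / a)))
    (hf : ∀ y : ℝ, 0 < y → ∃ f : ℝ, 0 < f ∧
      HasDerivWithinAt (fun x : ℝ => P.real {ω | Y ω ≤ x}) f (S y) y) :
    SmoothWithin S (mixedCall k q P Y) := by
  choose! f hfpos hf using hf
  refine ⟨_, _, hasStrikeDerivs_mixedCall hk hYm hY hS hf, fun K hK => ?_⟩
  have hpos : ∀ i, 0 < f (K / k i) / k i := fun i =>
    div_pos (hfpos _ (div_pos hK (hk i))) (hk i)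
  obtain ⟨i, hi⟩ : ∃ i, 0 < q i := by
    by_contra! h
    have : ∑ i, q i ≤ 0 := Finset.sum_nonpos fun i _ => h i
    linarith
  exact Finset.sum_pos' (fun i _ => mul_nonneg (hq0 i) (hpos i).le)
    ⟨i, Finset.mem_univ _, mul_pos hi (hpos i)⟩

theorem withStart_smoothWithin {c : Fin M → ℝ → ℝ} {S : ℝ → Set ℝ}
    (hc : ∀ j, SmoothWithin S (c j)) {m : Fin (M + 1)} (hm : m ≠ 0) :
    SmoothWithin S (withStart c m) := by
  obtain ⟨j, rfl⟩ := Fin.exists_succ_eq.2 hm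
  exact hc j

theorem interpTime_smoothWithin (hM : 0 < M) (hT0 : T 0 = 0) (hT : StrictMono T)
    (hα : ∀ j, MonotoneOn (α j) (Icc (T j.castSucc) (T j.succ)))
    (hα0 : ∀ j, α j (T j.castSucc) = 0) (hα1 : ∀ j, α j (T j.succ) = 1)
    {c : Fin M → ℝ → ℝ} {S : ℝ → Set ℝ} (hc : ∀ j, SmoothWithin S (c j)) {t : ℝ≥0}
    (ht : T (Fin.succ ⟨0, hM⟩) ≤ t) : SmoothWithin S (interpTime T α (withStart c) t) := by
  rcases exists_mem_Ico_or_last_le hT0 t with ⟨j, hj⟩ | h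
  · rw [funext (interpTime_of_mem_Ico hT (withStart c) hj)]
    refine (withStart_smoothWithin hc (Fin.succ_ne_zero j)).mix
      (withStart_smoothWithin hc fun h0 => ?_)
      (mem_Icc_of_interpolation hα hα0 hα1 ⟨hj.1, hj.2.le⟩)
    -- A left endpoint `T 0` would force `t < T 1`, so from the first expiry on the initial prices
    -- never enter.
    have hj0 : j = ⟨0, hM⟩ := Fin.ext (by simpa using congrArg Fin.val h0)
    rw [hj0] at hj
    exact absurd hj.2 (not_lt.2 ht)
  · rw [funext (interpTime_of_last_le hT (withStart c) h)]
    refine withStart_smoothWithin hc fun h0 => ?_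
    have := congrArg Fin.val h0
    simp only [Fin.val_last, Fin.val_zero] at this
    omega

theorem interpTime_smoothWithin_Ioi (hM : 0 < M) (hT0 : T 0 = 0) (hT : StrictMono T)
    (hα : ∀ j, MonotoneOn (α j) (Icc (T j.castSucc) (T j.succ)))
    (hα0 : ∀ j, α j (T j.castSucc) = 0) (hα1 : ∀ j, α j (T j.succ) = 1)
    {c : Fin M → ℝ → ℝ} (hc : ∀ j, SmoothWithin Ioi (c j)) {t : ℝ≥0}
    (ht : t < T (Fin.succ ⟨0, hM⟩) → 0 < α ⟨0, hM⟩ t) :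
    SmoothWithin Ioi (interpTime T α (withStart c) t) := by
  rcases lt_or_ge t (T (Fin.succ ⟨0, hM⟩)) with h | h
  · have hmem : t ∈ Ico (T (Fin.castSucc ⟨0, hM⟩)) (T (Fin.succ ⟨0, hM⟩)) :=
      ⟨by simp [Fin.castSucc, hT0], h⟩
    rw [funext (interpTime_of_mem_Ico hT (withStart c) hmem)]
    exact (hc ⟨0, hM⟩).mix_start (ht h)
  · exact interpTime_smoothWithin hM hT0 hT hα hα0 hα1 hc h

end Smoothness

/-! ### The representing martingale of the whole surface -/

section Representation

variable {M N : ℕ} {Ω : Type*} {mΩ : MeasurableSpace Ω} {P : Measure Ω}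

theorem mixedCall_eq_of_identDistrib {Ω' : Type*} {mΩ' : MeasurableSpace Ω'} {P' : Measure Ω'}
    {k q : Fin N → ℝ} {Y : Ω → ℝ} {Y' : Ω' → ℝ} (h : IdentDistrib Y' Y P' P) (K : ℝ) :
    mixedCall k q P' Y' K = mixedCall k q P Y K := by
  refine Finset.sum_congr rfl fun i _ => ?_
  have hcall : Measurable fun y : ℝ => max (k i * y - K) 0 := by fun_prop
  exact congrArg (q i * ·) (h.comp hcall).integral_eq

theorem IsMartingaleWithDensity.measurable {k : Fin N → ℝ} {q : Fin M → Fin N → ℝ}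
    {X : Fin M → Ω → ℝ} (h : IsMartingaleWithDensity k q P X) (j : Fin M) : Measurable (X j) := by
  obtain ⟨𝓗, h𝓗⟩ := h.martingale
  exact measurable_of_martingale h𝓗 j

theorem IsMartingaleWithDensity.of_identDistrib [IsProbabilityMeasure P] {Ω' : Type*}
    {mΩ' : MeasurableSpace Ω'} {P' : Measure Ω'} [IsProbabilityMeasure P'] {k : Fin N → ℝ}
    {q : Fin M → Fin N → ℝ} {X : Fin M → Ω → ℝ} (h : IsMartingaleWithDensity k q P X)
    {X' : Fin M → Ω' → ℝ} (hX' : ∀ j, Measurable (X' j))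
    (hid : IdentDistrib (fun ω j => X' j ω) (fun ω j => X j ω) P' P) :
    IsMartingaleWithDensity k q P' X' := by
  obtain ⟨𝓗, h𝓗⟩ := h.martingale
  refine ⟨⟨_, h𝓗.of_identDistrib hX' hid⟩, fun j i => ?_⟩
  rw [← h.law j i]
  exact congrArg ENNReal.toReal
    ((hid.comp (measurable_pi_apply j)).measure_mem_eq (measurableSet_singleton (k i)))

theorem exists_modelSurface_representation (hM : 0 < M) {T : Fin (M + 1) → ℝ≥0} (hT0 : T 0 = 0)
    (hT : StrictMono T) {α : Fin M → ℝ≥0 → ℝ}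
    (hα : ∀ j, MonotoneOn (α j) (Icc (T j.castSucc) (T j.succ)))
    (hα0 : ∀ j, α j (T j.castSucc) = 0) (hα1 : ∀ j, α j (T j.succ) = 1)
    {k : Fin N → ℝ} (hk : Function.Injective k) (hkpos : ∀ i, 0 < k i) [IsProbabilityMeasure P]
    {𝒢 : Filtration (Fin M) mΩ} {Y : Fin M → Ω → ℝ} (hY : Martingale Y 𝒢 P)
    (hYpos : ∀ j, ∀ᵐ ω ∂P, 0 < Y j ω) (hYmean : ∀ j, ∫ ω, Y j ω ∂P = 1)
    {q : Fin M → Fin N → ℝ} (hq : IsMartingaleDensity k q) :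
    ∃ (Ω' : Type) (mΩ' : MeasurableSpace Ω') (P' : Measure Ω') (_ : IsProbabilityMeasure P')
        (ℱ : Filtration ℝ≥0 mΩ') (Z : ℝ≥0 → Ω' → ℝ) (X Y' : Fin M → Ω' → ℝ),
      IsMartingaleWithDensity k q P' X ∧
      IdentDistrib (fun ω j => Y' j ω) (fun ω j => Y j ω) P' P ∧
      IndepFun (fun ω j => X j ω) (fun ω j => Y' j ω) P' ∧
      IsMartingaleRepresentation (modelSurface T α k q P Y) P' ℱ Z ∧
      ∀ j : Fin M, ∀ᵐ ω ∂P', Z (T j.succ) ω = X j ω * Y' j ω := by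
  obtain ⟨Ωx, mx, Px, hPx, X, hX⟩ := exists_isMartingaleWithDensity hM hk hq
  have hXm : Measurable fun ω j => X j ω := measurable_pi_lambda _ hX.measurable
  have hYm : Measurable fun ω j => Y j ω := measurable_pi_lambda _ (measurable_of_martingale hY)
  have hPy : IsProbabilityMeasure (P.map fun ω j => Y j ω) :=
    Measure.isProbabilityMeasure_map hYm.aemeasurable
  -- `Y` is replaced by the coordinate process under its law on path space. This keeps the joint
  -- law, brings the space into `Type`, and makes independence from `X` a matter of taking a product
  -- measure.
  set Q := Px.prod (P.map fun ω j => Y j ω) with hQ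
  set X₁ : Fin M → Ωx × (Fin M → ℝ) → ℝ := fun j ω => X j ω.1 with hX₁
  set Y₁ : Fin M → Ωx × (Fin M → ℝ) → ℝ := fun j ω => ω.2 j with hY₁
  have hX₁m : ∀ j, Measurable (X₁ j) := fun j => (hX.measurable j).comp measurable_fst
  have hY₁m : ∀ j, Measurable (Y₁ j) := fun j => (measurable_pi_apply j).comp measurable_snd
  have hX₁q : IsMartingaleWithDensity k q Q X₁ :=
    hX.of_identDistrib hX₁m (identDistrib_comp_fst Px _ hXm)
  have hidY : IdentDistrib (fun ω j => Y₁ j ω) (fun ω j => Y j ω) Q P :=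
    (identDistrib_comp_snd Px _ measurable_id).trans
      ⟨aemeasurable_id, hYm.aemeasurable, by rw [Measure.map_id]⟩
  have hidYj : ∀ j, IdentDistrib (Y₁ j) (Y j) Q P := fun j => hidY.comp (measurable_pi_apply j)
  have hYmart := hY.of_identDistrib hY₁m hidY
  have hind : IndepFun (fun ω j => X₁ j ω) (fun ω j => Y₁ j ω) Q := indepFun_prod hXm measurable_id
  have hindj : ∀ j, IndepFun (X₁ j) (Y₁ j) Q := fun j =>
    hind.comp (measurable_pi_apply j) (measurable_pi_apply j)
  have hYpos₁ : ∀ j, ∀ᵐ ω ∂Q, 0 < Y₁ j ω := fun j =>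
    (hidYj j).symm.ae_snd (p := fun y => 0 < y) measurableSet_Ioi (hYpos j)
  have hWpos : ∀ j, ∀ᵐ ω ∂Q, 0 < X₁ j ω * Y₁ j ω := fun j =>
    ae_mul_pos hk hkpos (hq.sum_one j) (hX₁m j) (hX₁q.law j) (hYpos₁ j)
  have hprice : ∀ j K, ∫ ω, max (X₁ j ω * Y₁ j ω - K) 0 ∂Q = mixedCall k (q j) P (Y j) K :=
    fun j K => (integral_call_mul hk (hq.sum_one j) (hX₁m j) (hYmart.integrable j)
      (hX₁q.law j) (hindj j) K).trans (mixedCall_eq_of_identDistrib (hidYj j) K)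
  -- The mean is the price at strike zero, by positivity.
  have hmean : ∀ j, ∫ ω, X₁ j ω * Y₁ j ω ∂Q = 1 := by
    intro j
    rw [← mixedCall_zero hkpos (hq.unit_mean j) (hYpos j) (hYmean j), ← hprice]
    refine integral_congr_ae ?_
    filter_upwards [hWpos j] with ω h
    rw [sub_zero, max_eq_left h.le]
  obtain ⟨𝓗, h𝓗⟩ := hX₁q.martingale
  obtain ⟨𝓚, h𝓚⟩ := exists_martingale_mul h𝓗 hYmart hind
  obtain ⟨𝓚', h𝓚'⟩ := exists_martingale_cons h𝓚 hmean
  obtain ⟨ℱ, Z, hZ, hnode⟩ := exists_representation_interpTime hT0 hT hα hα0 hα1 h𝓚'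
    (c := withStart fun j => mixedCall k (q j) P (Y j)) (.of_forall fun ω => rfl)
    (fun j => by
      induction j using Fin.cases with
      | zero => exact .of_forall fun ω => one_pos
      | succ j => exact hWpos j)
    (fun j K _ => by
      induction j using Fin.cases with
      | zero => simp [withStart]
      | succ j => exact hprice j K)
  set U := (volume : Measure ℝ).restrict (Ioc 0 1)
  have hX₁path : Measurable fun ω j => X₁ j ω := measurable_pi_lambda _ hX₁m
  have hY₁path : Measurable fun ω j => Y₁ j ω := measurable_pi_lambda _ hY₁m
  -- The time change lives on the product with the uniform variable, so `X` and `Y` are pulled back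
  -- along the second projection; their laws and their independence survive because the joint law of
  -- the pair is unchanged.
  refine ⟨_, _, U.prod Q, inferInstance, ℱ, Z, fun j ω => X₁ j ω.2, fun j ω => Y₁ j ω.2,
    hX₁q.of_identDistrib (fun j => (hX₁m j).comp measurable_snd)
      (identDistrib_comp_snd U Q hX₁path),
    (identDistrib_comp_snd U Q hY₁path).trans hidY,
    indepFun_of_identDistrib_pair hind
      (identDistrib_comp_snd U Q (hX₁path.prodMk hY₁path)).symm,
    hZ, fun j => hnode j.succ⟩

end Representation

end SmoothCalls

/-! ### The theorem -/

open SmoothCalls in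
theorem mainTheorem1
    {M N : ℕ} (hM : 0 < M)
    -- expiries `0 = T_0 < ⋯ < T_M` and increasing interpolation functions in time
    (T : Fin (M + 1) → ℝ≥0) (hT0 : T 0 = 0) (hT : StrictMono T)
    (α : Fin M → ℝ≥0 → ℝ)
    (hα : ∀ j, MonotoneOn (α j) (Icc (T j.castSucc) (T j.succ)))
    (hα0 : ∀ j, α j (T j.castSucc) = 0) (hα1 : ∀ j, α j (T j.succ) = 1)
    -- strikes `0 = K^0 < K^1 < ⋯ < K^N`
    (Kg : Fin (N + 1) → ℝ) (hK0 : Kg 0 = 0) (hK : StrictMono Kg)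
    -- a positive unit-mean martingale `Y_1, …, Y_M`
    {Ω : Type*} {mΩ : MeasurableSpace Ω} (P : Measure Ω) [IsProbabilityMeasure P]
    (𝒢 : Filtration (Fin M) mΩ) (Y : Fin M → Ω → ℝ) (hY : Martingale Y 𝒢 P)
    (hYpos : ∀ j, ∀ᵐ ω ∂P, 0 < Y j ω) (hYmean : ∀ j, ∫ ω, Y j ω ∂P = 1)
    -- a martingale density `q_1, …, q_M` on the strikes `K^1, …, K^N`
    (q : Fin M → Fin N → ℝ) (hq : IsMartingaleDensity (fun i => Kg i.succ) q) :
    -- the surface is an arbitrage-free call price function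
    IsArbitrageFree (modelSurface T α (fun i => Kg i.succ) q P Y) ∧
    -- it is smooth in strike at each `t > 0` (with `α_0(t) > 0` if `t < T_1`), if the distribution
    -- functions of the `Y_j` have strictly positive right-hand derivatives on `(0, ∞)`
    ((∀ j, ∀ y : ℝ, 0 < y → ∃ f : ℝ, 0 < f ∧
        HasDerivWithinAt (fun x : ℝ => P.real {ω | Y j ω ≤ x}) f (Ioi y) y) →
      ∀ t : ℝ≥0, 0 < t → (t < T (Fin.succ ⟨0, hM⟩) → 0 < α ⟨0, hM⟩ t) →
        IsSmoothInStrike (modelSurface T α (fun i => Kg i.succ) q P Y t)) ∧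
    -- from `T_1` on, it is smooth with two-sided derivatives, if the distribution functions have
    -- strictly positive two-sided derivatives on `(0, ∞)`
    ((∀ j, ∀ y : ℝ, 0 < y → ∃ f : ℝ, 0 < f ∧
        HasDerivAt (fun x : ℝ => P.real {ω | Y j ω ≤ x}) f y) →
      ∀ t : ℝ≥0, T (Fin.succ ⟨0, hM⟩) ≤ t →
        IsTwoSidedSmoothInStrike (modelSurface T α (fun i => Kg i.succ) q P Y t)) ∧
    -- for every `X ∼ q` independent of `Y`, the product `X_j Y_j` is a positive martingale with
    -- the call prices of the model
    (∀ X : Fin M → Ω → ℝ, IsMartingaleWithDensity (fun i => Kg i.succ) q P X →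
      IndepFun (fun ω j => X j ω) (fun ω j => Y j ω) P →
      (∃ 𝓗 : Filtration (Fin M) mΩ, Martingale (fun j ω => X j ω * Y j ω) 𝓗 P) ∧
      ∀ j, (∀ᵐ ω ∂P, 0 < X j ω * Y j ω) ∧
        ∀ K : ℝ, 0 ≤ K →
          ∫ ω, max (X j ω * Y j ω - K) 0 ∂P = mixedCall (fun i => Kg i.succ) (q j) P (Y j) K) ∧
    -- on a suitable probability space there are a copy of `Y`, an independent `X ∼ q`, and a
    -- martingale representation `Z` of the whole surface with `Z_{T_j} = X_j Y_j`
    (∃ (Ω' : Type) (mΩ' : MeasurableSpace Ω') (P' : Measure Ω') (_ : IsProbabilityMeasure P')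
        (ℱ : Filtration ℝ≥0 mΩ') (Z : ℝ≥0 → Ω' → ℝ) (X Y' : Fin M → Ω' → ℝ),
      IsMartingaleWithDensity (fun i => Kg i.succ) q P' X ∧
      IdentDistrib (fun ω j => Y' j ω) (fun ω j => Y j ω) P' P ∧
      IndepFun (fun ω j => X j ω) (fun ω j => Y' j ω) P' ∧
      IsMartingaleRepresentation (modelSurface T α (fun i => Kg i.succ) q P Y) P' ℱ Z ∧
      ∀ j : Fin M, ∀ᵐ ω ∂P', Z (T j.succ) ω = X j ω * Y' j ω) ∧
    -- comparison with linear interpolation of arbitrage-free market prices if `q` is their density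
    (∀ C : Fin M → Fin (N + 1) → ℝ, IsArbitrageFreeMarket Kg C →
      (∀ j, q j = marketDensity Kg (C j)) →
      (∀ j, ∀ K : ℝ, 0 ≤ K →
        linearCall Kg (C j) K ≤ mixedCall (fun i => Kg i.succ) (q j) P (Y j) K) ∧
      (∀ j, (∀ᵐ ω ∂P, Y j ω = 1) → ∀ K : ℝ, 0 ≤ K →
        mixedCall (fun i => Kg i.succ) (q j) P (Y j) K = linearCall Kg (C j) K) ∧
      ((∀ j, ∀ᵐ ω ∂P, Y j ω = 1) → ∀ (t : ℝ≥0) (K : ℝ), 0 ≤ K →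
        modelSurface T α (fun i => Kg i.succ) q P Y t K = linearSurface T α Kg C t K)) := by
  have hk : StrictMono fun i : Fin N => Kg i.succ := hK.comp (Fin.strictMono_succ)
  have hkpos : ∀ i : Fin N, 0 < Kg i.succ := fun i => hK0 ▸ hK (Fin.succ_pos i)
  have hYm := SmoothCalls.measurable_of_martingale hY
  have hrep := exists_modelSurface_representation hM hT0 hT hα hα0 hα1 hk.injective hkpos hY hYpos
    hYmean hq
  refine ⟨?_, fun hf t _ ht => ?_, fun hf t ht => ?_, fun X hX hind => ⟨?_, fun j => ⟨?_, ?_⟩⟩,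
    hrep, fun C hC hqC => ?_⟩
  · obtain ⟨Ω', mΩ', P', hP', ℱ, Z, -, -, -, -, -, hZ, -⟩ := hrep
    exact ⟨Ω', mΩ', P', hP', ℱ, Z, hZ⟩
  · refine (interpTime_smoothWithin_Ioi hM hT0 hT hα hα0 hα1 (fun j => ?_) ht).isSmoothInStrike
    exact smoothWithin_mixedCall hkpos (hq.nonneg j) (hq.sum_one j) (hYm j) (hY.integrable j)
      (fun a K ha x hx => div_lt_div_of_pos_right hx ha) (hf j)
  · refine (interpTime_smoothWithin hM hT0 hT hα hα0 hα1 (fun j => ?_) ht).isTwoSidedSmoothInStrike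
    exact smoothWithin_mixedCall hkpos (hq.nonneg j) (hq.sum_one j) (hYm j) (hY.integrable j)
      (fun a K _ => mapsTo_univ _ _)
      fun y hy => (hf j y hy).imp fun f h => ⟨h.1, h.2.hasDerivWithinAt⟩
  · obtain ⟨𝓗, h𝓗⟩ := hX.martingale
    exact exists_martingale_mul h𝓗 hY hind
  · exact ae_mul_pos hk.injective hkpos (hq.sum_one j) (hX.measurable j) (hX.law j) (hYpos j)
  · exact fun K _ => integral_call_mul hk.injective (hq.sum_one j) (hX.measurable j)
      (hY.integrable j) (hX.law j)
      (hind.comp (measurable_pi_apply j) (measurable_pi_apply j)) K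
  -- With `q` the market density, the linear interpolant is the mixture of the payoffs $(K^i-K)^+$;
  -- both the inequality and the case `Y = 1` are read off from this form.
  · have hlin : ∀ j, ∀ K : ℝ, 0 ≤ K →
        linearCall Kg (C j) K = ∑ i, q j i * max (Kg i.succ - K) 0 := fun j K h => by
      rw [linearCall_eq_sum hK0 hK (hC.reaches_zero j) h, hqC j]
    have heq : ∀ j, (∀ᵐ ω ∂P, Y j ω = 1) → ∀ K : ℝ, 0 ≤ K →
        mixedCall (fun i => Kg i.succ) (q j) P (Y j) K = linearCall Kg (C j) K :=
      fun j h K h0 => (mixedCall_of_ae_eq_one h K).trans (hlin j K h0).symm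
    refine ⟨fun j K h => ?_, heq, fun h t K h0 => interpTime_congr (fun m => ?_) t⟩
    · rw [hlin j K h]
      exact sum_intrinsic_le_mixedCall (hq.nonneg j) (hY.integrable j) (hYmean j) K
    · induction m using Fin.cases with
      | zero => rfl
      | succ j => exact heq j (h j) K h0
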